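/- **Proposition (explicit expression for the resolvent of $\mathcal A$).** Let $a,b,\alpha>0$, $\xi\in(0,1)$, $\mu\in\mathbb C$. Let $\mathcal H=[H^2(0,1)\cap H^1_0(0,1)]\times L^2(0,1)$ (complex-valued functions) and let $\mathcal A:D(\mathcal A)\to\mathcal H$ be $$\mathcal A(u,v)=\bigl(v,\,-a\,u_{xxxx}-b\,v-\alpha\,v(\xi)\,\delta_\xi\bigr)$$ (derivatives in the sense of distributions on $(0,1)$), where $D(\mathcal A)$ is the set of $(u,v)\in\mathcal H$ with $u\in H^4(0,\xi)\cap H^4(\xi,1)\cap H^2(0,1)$, $v\in H^2(0,1)$, $u=v=0$ and $u_{xx}=0$ at $x=0$ and $x=1$, $u_{xx}(\xi^-)=u_{xx}(\xi^+)$ and $u_{xxx}(\xi^+)-u_{xxx}(\xi^-)=-\frac{\alpha}{a}v(\xi)$. Let $F=(u_1,v_1)\in\mathcal H$, let $\lambda\in\mathbb C$ satisfy $\lambda^4=-(b\mu+\mu^2)/a$, and let $H(x)=1$ for $x\ge 0$, $H(x)=0$ for $x<0$. For $x\in[0,1]$ write $(\psi\star f)(x)=\int_0^x\psi(x-s)f(s)\,ds$;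 when derivatives are taken at $x=1$, $f$ is extended by $0$ outside $[0,1]$. Put $$f_1^0=(\mu+b)u_1+v_1,\qquad u_0(\lambda,x)=\frac{\sinh(\lambda x)-\sin(\lambda x)}{2a\lambda^3}\,H(x),$$ $$Det^\alpha(\lambda)=4\lambda^2\Bigl\{\bigl[-2\lambda^3\sinh\lambda-\tfrac{\alpha\mu}{a}\sinh(\lambda\xi)\sinh(\lambda(\xi-1))\bigr]\sin\lambda+\tfrac{\alpha\mu}{a}\sin(\lambda\xi)\sinh\lambda\,\sin(\lambda(\xi-1))\Bigr\},$$ $$Det^0(\lambda)=-8\lambda^5\sinh\lambda\,\sin\lambda,$$ $$A=\lambda^2(u_0\star f_1^0)(1)+\lambda^2\alpha\,u_1(\xi)\,u_0(\lambda,1-\xi),\quad B=(u_0\star f_1^0)_{xx}(1)+\alpha\,u_1(\xi)\,u_{0,xx}(\lambda,1-\xi),\quad C=\lambda^2(u_0\star f_1^0)(\xi),$$ $$\Delta=\tfrac{4\lambda^2\mu}{a}\bigl(\sin(\lambda\xi)\sin(\lambda(\xi-1))\sinh\lambda-\sinh(\lambda\xi)\sinh(\lambda(\xi-1))\sin\lambda\bigr),$$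 $$\Delta_3=\tfrac{4\lambda\mu}{a}\Bigl\{\sin(\lambda(\xi-1))\bigl(\tfrac{A+B}{2}[\sinh(\lambda\xi)-\sin(\lambda\xi)]-C\sinh\lambda\bigr)+\sinh(\lambda(\xi-1))\bigl(\tfrac{A-B}{2}[\sinh(\lambda\xi)-\sin(\lambda\xi)]+C\sin\lambda\bigr)\Bigr\},$$ $$\Delta_1=\tfrac{4\lambda^3\mu}{a}\Bigl\{\sin(\lambda(\xi-1))\bigl(-\tfrac{A+B}{2}[\sinh(\lambda\xi)+\sin(\lambda\xi)]+C\sinh\lambda\bigr)+\sinh(\lambda(\xi-1))\bigl(-\tfrac{A-B}{2}[\sinh(\lambda\xi)+\sin(\lambda\xi)]+C\sin\lambda\bigr)\Bigr\},$$ $$\Delta_0=-4\lambda^3\bigl\{2C\sin\lambda\sinh\lambda-(A+B)\sin\lambda\sinh(\lambda\xi)-(A-B)\sin(\lambda\xi)\sinh\lambda\bigr\},$$ $$R(x)=(u_0\star f_1^0)(x)+\frac{a}{Det^0(\lambda)}\Bigl[4\lambda^4\{(A-B)\sinh\lambda+(A+B)\sin\lambda\}\,u_{0,xx}(\lambda,x)+4\lambda^6\{(A+B)\sin\lambda-(A-B)\sinh\lambda\}\,u_0(\lambda,x)\Bigr].$$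 ($R$ depends on $\alpha$ only through $A$ and $B$; formally, for $\alpha=0$ it is the resolvent of $\mathcal A$ with $\alpha=0$.) If $Det^\alpha(\lambda)\ne 0$ (in particular $\lambda\neq0$), then $(\mu I-\mathcal A)U=F$ has exactly one solution $U=(u,v)\in D(\mathcal A)$, and for all $x\in[0,1]$ $$u(x)=\frac{1}{Det^\alpha(\lambda)}\Bigl(Det^0(\lambda)R(x)+\alpha\bigl[\Delta\,(u_0\star f_1^0)(x)+a\Delta_1u_0(\lambda,x)+a\Delta_3u_{0,xx}(\lambda,x)+\bigl(u_1(\xi)\,Det^\alpha(\lambda)-\mu\Delta_0\bigr)u_0(\lambda,x-\xi)\bigr]\Bigr),$$ $$v(x)=\mu u(x)-u_1(x),$$ where, if $Det^0(\lambda)=0$, the product $Det^0(\lambda)R(x)$ is read with the denominator $Det^0(\lambda)$ cleared. -/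

import Mathlib

open MeasureTheory
open scoped ContDiff

noncomputable section

namespace Beam

/-- Complex-valued test functions on the open interval `(c, d)`. -/
structure IsTestFunction (c d : ℝ) (φ : ℝ → ℂ) : Prop where
  smooth : ContDiff ℝ ∞ φ
  compact : HasCompactSupport φ
  support : tsupport φ ⊆ Set.Ioo c d

/-- `g` is the weak (distributional) derivative of `f` on `(c, d)`. -/
def HasWeakDeriv (c d : ℝ) (f g : ℝ → ℂ) : Prop :=
  ∀ φ : ℝ → ℂ, IsTestFunction c d φ →
    ∫ x in Set.Ioo c d, f x * deriv φ x = -∫ x in Set.Ioo c d, g x * φ x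

/-- `f` belongs to `L²(c, d)`. -/
def MemL2 (c d : ℝ) (f : ℝ → ℂ) : Prop :=
  MemLp f 2 (volume.restrict (Set.Ioo c d))

/-- `D 0 = u, D 1, …, D m` are the weak derivatives of `u ∈ H^m(c, d)`, where `D j` for `j < m`
is the continuous representative on `[c, d]` (which exists for every element of `H^m(c, d)`), so
that `D j x` for `x ∈ [c, d]` and `j < m` is the value (or one-sided trace) at `x` of the `j`-th
derivative of `u`. The values of the functions outside `[c, d]` are irrelevant. -/
structure IsSobolevDerivs (m : ℕ) (c d : ℝ) (u : ℝ → ℂ) (D : ℕ → ℝ → ℂ) : Prop where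
  zero : ∀ x ∈ Set.Icc c d, D 0 x = u x
  cont : ∀ j, j < m → ContinuousOn (D j) (Set.Icc c d)
  memL2 : ∀ j, j ≤ m → MemL2 c d (D j)
  deriv : ∀ j, j < m → HasWeakDeriv c d (D j) (D (j + 1))

/-- `u` is (the continuous representative of) an element of `H^m(c, d)`, `m ≥ 1`. -/
def MemSobolev (m : ℕ) (c d : ℝ) (u : ℝ → ℂ) : Prop :=
  ∃ D : ℕ → ℝ → ℂ, IsSobolevDerivs m c d u D

/-- `(u, v) ∈ 𝓗 = [H²(0,1) ∩ H¹₀(0,1)] × L²(0,1)`. -/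
structure InEnergySpace (u v : ℝ → ℂ) : Prop where
  sobolev : MemSobolev 2 0 1 u
  left : u 0 = 0
  right : u 1 = 0
  memL2 : MemL2 0 1 v

/-- `(u, v) ∈ D(𝒜)`. The functions `l j` and `r j` are the `j`-th derivatives of `u` on `(0, ξ)`
and on `(ξ, 1)`. -/
structure InDomain (a α ξ : ℝ) (u v : ℝ → ℂ) : Prop where
  energy : InEnergySpace u v
  sobolev_snd : MemSobolev 2 0 1 v
  left_snd : v 0 = 0
  right_snd : v 1 = 0
  pieces : ∃ l r : ℕ → ℝ → ℂ,
    IsSobolevDerivs 4 0 ξ u l ∧ IsSobolevDerivs 4 ξ 1 u r ∧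
    l 2 0 = 0 ∧ r 2 1 = 0 ∧ l 2 ξ = r 2 ξ ∧
    r 3 ξ - l 3 ξ = -((α : ℂ) / a) * v ξ

/-- `𝒜(u, v) = (w, z)`, that is, `w = v` and `z ∈ L²(0,1)` equals
`-a u⁗ - b v - α v(ξ) δ_ξ` in the sense of distributions on `(0, 1)`. -/
structure OperatorMapsTo (a b α ξ : ℝ) (u v w z : ℝ → ℂ) : Prop where
  domain : InDomain a α ξ u v
  fst : ∀ x ∈ Set.Icc (0 : ℝ) 1, w x = v x
  memL2 : MemL2 0 1 z
  snd : ∀ φ : ℝ → ℂ, IsTestFunction 0 1 φ →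
    ∫ x in Set.Ioo (0 : ℝ) 1, z x * φ x =
      -(a : ℂ) * (∫ x in Set.Ioo (0 : ℝ) 1, u x * iteratedDeriv 4 φ x)
        - (b : ℂ) * (∫ x in Set.Ioo (0 : ℝ) 1, v x * φ x)
        - (α : ℂ) * v ξ * φ ξ

/-- `(u, v) ∈ D(𝒜)` and `(μ I - 𝒜)(u, v) = (u₁, v₁)` in `𝓗`. -/
def SolvesResolvent (a b α ξ : ℝ) (μ : ℂ) (u₁ v₁ u v : ℝ → ℂ) : Prop :=
  ∃ w z : ℝ → ℂ, OperatorMapsTo a b α ξ u v w z ∧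
    (∀ x ∈ Set.Icc (0 : ℝ) 1, μ * u x - w x = u₁ x) ∧
    (∀ᵐ x ∂(volume.restrict (Set.Ioo (0 : ℝ) 1)), μ * v x - z x = v₁ x)

/-- The convolution of `ψ`, extended by zero to `(-∞, 0)`, and of `f`, extended by zero outside
`[0, 1]`. On `[0, 1]` it is `∫₀ˣ ψ(x - s) f(s) ds`. -/
def conv (ψ f : ℝ → ℂ) (x : ℝ) : ℂ :=
  ∫ s in (0 : ℝ)..x, ψ (x - s) * (Set.Icc (0 : ℝ) 1).indicator f s

/-- `f₁⁰ = (μ + b) u₁ + v₁`. -/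
def f10 (b : ℝ) (μ : ℂ) (u₁ v₁ : ℝ → ℂ) (x : ℝ) : ℂ :=
  (μ + b) * u₁ x + v₁ x

/-- The Heaviside step function at `0`. -/
def heaviside (x : ℝ) : ℂ := if 0 ≤ x then 1 else 0

/-- `u₀(λ, x) = (sinh (λ x) - sin (λ x)) H(x, 0) / (2 a λ³)`, whose Laplace transform is
`1 / (a p⁴ - a λ⁴)`. -/
def u0 (a : ℝ) (lam : ℂ) (x : ℝ) : ℂ :=
  1 / (2 * a * lam ^ 3) * (Complex.sinh (lam * x) - Complex.sin (lam * x)) * heaviside x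

/-- The second derivative `u_{0,xx}(λ, x)`. -/
def u0xx (a : ℝ) (lam : ℂ) (x : ℝ) : ℂ :=
  iteratedDeriv 2 (u0 a lam) x

/-- `Det^α(λ)`. -/
def detAlpha (a α ξ : ℝ) (μ lam : ℂ) : ℂ :=
  4 * lam ^ 2 *
    ((-2 * lam ^ 3 * Complex.sinh lam
        - α * μ / a * Complex.sinh (lam * ξ) * Complex.sinh (lam * (ξ - 1))) * Complex.sin lam
      + α * μ / a * Complex.sin (lam * ξ) * Complex.sinh lam * Complex.sin (lam * (ξ - 1)))

/-- `Det⁰(λ)`. -/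
def detZero (lam : ℂ) : ℂ :=
  -8 * lam ^ 5 * Complex.sinh lam * Complex.sin lam

/-- `A(λ, α)`. -/
def coeffA (a b α ξ : ℝ) (μ lam : ℂ) (u₁ v₁ : ℝ → ℂ) : ℂ :=
  lam ^ 2 * conv (u0 a lam) (f10 b μ u₁ v₁) 1 + lam ^ 2 * α * u₁ ξ * u0 a lam (1 - ξ)

/-- `B(λ, α)`. -/
def coeffB (a b α ξ : ℝ) (μ lam : ℂ) (u₁ v₁ : ℝ → ℂ) : ℂ :=
  iteratedDeriv 2 (conv (u0 a lam) (f10 b μ u₁ v₁)) 1 + α * u₁ ξ * u0xx a lam (1 - ξ)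

/-- `C(λ, ξ)`. -/
def coeffC (a b ξ : ℝ) (μ lam : ℂ) (u₁ v₁ : ℝ → ℂ) : ℂ :=
  lam ^ 2 * conv (u0 a lam) (f10 b μ u₁ v₁) ξ

/-- The bracket in the definition of `R(μ, 𝒜₀)F`. -/
def bracketZero (a : ℝ) (lam A B : ℂ) (x : ℝ) : ℂ :=
  4 * lam ^ 4 * ((A - B) * Complex.sinh lam + (A + B) * Complex.sin lam) * u0xx a lam x
    + 4 * lam ^ 6 * ((A + B) * Complex.sin lam - (A - B) * Complex.sinh lam) * u0 a lam x

/-- `R(μ, 𝒜₀)F`; meaningful when `Det⁰(λ) ≠ 0`. -/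
def resolventZero (a b α ξ : ℝ) (μ lam : ℂ) (u₁ v₁ : ℝ → ℂ) (x : ℝ) : ℂ :=
  conv (u0 a lam) (f10 b μ u₁ v₁) x
    + a / detZero lam *
      bracketZero a lam (coeffA a b α ξ μ lam u₁ v₁) (coeffB a b α ξ μ lam u₁ v₁) x

/-- `Det⁰(λ) · R(μ, 𝒜₀)F` with the denominator `Det⁰(λ)` cleared, so that it also makes sense
when `Det⁰(λ) = 0`. -/
def detZeroResolventZero (a b α ξ : ℝ) (μ lam : ℂ) (u₁ v₁ : ℝ → ℂ) (x : ℝ) : ℂ :=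
  detZero lam * conv (u0 a lam) (f10 b μ u₁ v₁) x
    + a * bracketZero a lam (coeffA a b α ξ μ lam u₁ v₁) (coeffB a b α ξ μ lam u₁ v₁) x

/-- `Δ(λ, ξ)`. -/
def Delta (a ξ : ℝ) (μ lam : ℂ) : ℂ :=
  4 * lam ^ 2 * μ / a *
    (Complex.sin (lam * ξ) * Complex.sin (lam * (ξ - 1)) * Complex.sinh lam
      - Complex.sinh (lam * ξ) * Complex.sinh (lam * (ξ - 1)) * Complex.sin lam)

/-- `Δ₃(λ, ξ)`. -/
def Delta3 (a ξ : ℝ) (μ lam A B C : ℂ) : ℂ :=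
  4 * lam * μ / a *
    (Complex.sin (lam * (ξ - 1)) *
        ((A + B) / 2 * (Complex.sinh (lam * ξ) - Complex.sin (lam * ξ)) - C * Complex.sinh lam)
      + Complex.sinh (lam * (ξ - 1)) *
        ((A - B) / 2 * (Complex.sinh (lam * ξ) - Complex.sin (lam * ξ)) + C * Complex.sin lam))

/-- `Δ₁(λ, ξ)`. -/
def Delta1 (a ξ : ℝ) (μ lam A B C : ℂ) : ℂ :=
  4 * lam ^ 3 * μ / a *
    (Complex.sin (lam * (ξ - 1)) *
        (-((A + B) / 2) * (Complex.sinh (lam * ξ) + Complex.sin (lam * ξ)) + C * Complex.sinh lam)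
      + Complex.sinh (lam * (ξ - 1)) *
        (-((A - B) / 2) * (Complex.sinh (lam * ξ) + Complex.sin (lam * ξ)) + C * Complex.sin lam))

/-- `Δ₀(λ, ξ)`. -/
def Delta0 (ξ : ℝ) (lam A B C : ℂ) : ℂ :=
  -4 * lam ^ 3 *
    (2 * C * Complex.sin lam * Complex.sinh lam
      - (A + B) * Complex.sin lam * Complex.sinh (lam * ξ)
      - (A - B) * Complex.sin (lam * ξ) * Complex.sinh lam)

/-- The `α`-correction in the resolvent formula:
`Δ (u₀ ⋆ f₁⁰)(x) + a Δ₁ u₀(λ,x) + a Δ₃ u_{0,xx}(λ,x) + (u₁(ξ) Det^α(λ) - μ Δ₀) u₀(λ, x - ξ)`. -/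
def correction (a b α ξ : ℝ) (μ lam : ℂ) (u₁ v₁ : ℝ → ℂ) (x : ℝ) : ℂ :=
  let A := coeffA a b α ξ μ lam u₁ v₁
  let B := coeffB a b α ξ μ lam u₁ v₁
  let C := coeffC a b ξ μ lam u₁ v₁
  Delta a ξ μ lam * conv (u0 a lam) (f10 b μ u₁ v₁) x
    + a * Delta1 a ξ μ lam A B C * u0 a lam x
    + a * Delta3 a ξ μ lam A B C * u0xx a lam x
    + (u₁ ξ * detAlpha a α ξ μ lam - μ * Delta0 ξ lam A B C) * u0 a lam (x - ξ)

end Beam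

end

noncomputable section

namespace Beam

open Set Filter Topology

/-! The first component of the resolvent equation gives `v = μ u - u₁`. Inserting this in the second
and using `a λ⁴ = -(b μ + μ²)` turns it into `a u'''' - a λ⁴ u = f₁⁰ + α (u₁(ξ) - μ u(ξ)) δ_ξ`.
Since `u₀` is the causal fundamental solution of `a ∂⁴ - a λ⁴`, the conditions `u(0) = u''(0) = 0`
leave `u = u₀ ⋆ f₁⁰ + a c₁ u₀ + a c₃ u₀ₓₓ + α (u₁(ξ) - μ X) u₀(· - ξ)` with `c₁ = u'''(0)`, `c₃ =
u'(0)` and `X = u(ξ)`. The requirements `u(1) = 0`, `u''(1) = 0` and `u(ξ) = X` form a 3 × 3 linear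
system. In the unknowns `c₁ + λ² c₃`, `λ² c₃ - c₁`, `X` its determinant times `4 λ²` is `Det^α(λ)`,
so Cramer's rule gives existence, uniqueness and the formula together.

The analytic content is to pass between distributions and classical calculus.
`HasWeakDeriv.isPrimitiveOn` (du Bois-Reymond) makes Sobolev functions iterated primitives, and
`IsPrimitiveChain.eq_zero_of_fourth` gives uniqueness for the initial value problem.
`SolvesResolvent.representation` shows that every solution has the displayed form, and
`exists_solvesResolvent` is the converse. The algebra is in `isBoundaryData_iff`,
`IsBoundaryData.cramer` and `isBoundaryData_of_det_ne_zero`. -/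

/-! ### Fubini on a triangle. -/

/-- A continuous `Φ` is bounded on the compact square, so integrability of `f` alone suffices; the
indicator cuts out the triangle `s ≤ t`. -/
theorem integrable_triangle {Φ : ℝ → ℝ → ℂ} (hΦ : Continuous (Function.uncurry Φ)) {f : ℝ → ℂ}
    {c d : ℝ} (hf : IntegrableOn f (Ioc c d)) :
    Integrable (Function.uncurry fun t s => (Iic t).indicator (fun s => Φ t s * f s) s)
      ((volume.restrict (Ioc c d)).prod (volume.restrict (Ioc c d))) := by
  have hm : MeasurableSet {p : ℝ × ℝ | p.2 ≤ p.1} := measurableSet_le measurable_snd measurable_fst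
  have : Integrable (fun p : ℝ × ℝ => Φ p.1 p.2 * f p.2)
      ((volume.restrict (Ioc c d)).prod (volume.restrict (Ioc c d))) := by
    have h1 : Integrable (fun p : ℝ × ℝ => f p.2)
        ((volume.restrict (Ioc c d)).prod (volume.restrict (Ioc c d))) :=
      Integrable.comp_snd hf (volume.restrict (Ioc c d))
    obtain ⟨C, hC⟩ := (isCompact_Icc.prod isCompact_Icc : IsCompact
      (Icc c d ×ˢ Icc c d)).exists_bound_of_continuousOn hΦ.continuousOn
    refine h1.bdd_mul (c := C) hΦ.aestronglyMeasurable ?_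
    rw [Measure.prod_restrict]
    filter_upwards [ae_restrict_mem (measurableSet_Ioc.prod measurableSet_Ioc)] with p hp
    exact hC p ⟨Ioc_subset_Icc_self hp.1, Ioc_subset_Icc_self hp.2⟩
  refine (this.indicator hm).congr (ae_of_all _ fun p => ?_)
  simp [indicator, Function.uncurry]

theorem integral_triangle_eq {Φ : ℝ → ℝ → ℂ} {f : ℝ → ℂ} {c d t : ℝ} (ht : t ∈ Ioc c d) :
    ∫ s in Ioc c d, (Iic t).indicator (fun s => Φ t s * f s) s = ∫ s in c..t, Φ t s * f s := by
  rw [intervalIntegral.integral_of_le ht.1.le, setIntegral_indicator measurableSet_Iic,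
    Ioc_inter_Iic, min_eq_right ht.2]

theorem intervalIntegrable_triangle {Φ : ℝ → ℝ → ℂ} (hΦ : Continuous (Function.uncurry Φ))
    {f : ℝ → ℂ} {c d : ℝ} (hcd : c ≤ d) (hf : IntervalIntegrable f volume c d) :
    IntervalIntegrable (fun t => ∫ s in c..t, Φ t s * f s) volume c d := by
  rw [intervalIntegrable_iff_integrableOn_Ioc_of_le hcd] at hf ⊢
  refine (integrable_triangle hΦ hf).integral_prod_left.congr ?_
  filter_upwards [ae_restrict_mem measurableSet_Ioc] with t ht
  exact integral_triangle_eq ht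

/-- Interchange of the order of integration over a triangle. -/
theorem integral_triangle_swap {Φ : ℝ → ℝ → ℂ} (hΦ : Continuous (Function.uncurry Φ)) {f : ℝ → ℂ}
    {c d : ℝ} (hcd : c ≤ d) (hf : IntervalIntegrable f volume c d) :
    ∫ t in c..d, ∫ s in c..t, Φ t s * f s = ∫ s in c..d, (∫ t in s..d, Φ t s) * f s := by
  have hswap := integral_integral_swap
    (integrable_triangle hΦ ((intervalIntegrable_iff_integrableOn_Ioc_of_le hcd).1 hf))
  rw [intervalIntegral.integral_of_le hcd, intervalIntegral.integral_of_le hcd]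
  refine Eq.trans (setIntegral_congr_fun measurableSet_Ioc fun t ht =>
    (integral_triangle_eq ht).symm) (hswap.trans (setIntegral_congr_fun measurableSet_Ioc
    fun s hs => ?_))
  have h1 : (fun t => (Iic t).indicator (fun s => Φ t s * f s) s)
      = (Ici s).indicator fun t => Φ t s * f s := by
    ext t; simp [indicator]
  simp only [h1]
  rw [intervalIntegral.integral_of_le hs.2, setIntegral_indicator measurableSet_Ici,
    ← integral_mul_const]
  have : Ioc c d ∩ Ici s = Icc s d := by
    ext t; simp only [mem_inter_iff, mem_Ioc, mem_Ici, mem_Icc]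
    exact ⟨fun h => ⟨h.2, h.1.2⟩, fun h => ⟨⟨hs.1.trans_le h.1, h.2⟩, h.1⟩⟩
  rw [this, integral_Icc_eq_integral_Ioc]

/-! ### Test functions and square-integrable functions. -/

theorem IsTestFunction.deriv {c d : ℝ} {φ : ℝ → ℂ} (h : IsTestFunction c d φ) :
    IsTestFunction c d (deriv φ) where
  smooth := (contDiff_infty_iff_deriv.1 h.smooth).2
  compact := h.compact.deriv
  support := (closure_minimal support_deriv_subset (isClosed_tsupport φ)).trans h.support

theorem IsTestFunction.mono {c d c' d' : ℝ} {φ : ℝ → ℂ} (h : IsTestFunction c d φ)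
    (hc : c' ≤ c) (hd : d ≤ d') : IsTestFunction c' d' φ :=
  ⟨h.smooth, h.compact, h.support.trans (Ioo_subset_Ioo hc hd)⟩

theorem IsTestFunction.eq_zero {c d : ℝ} {φ : ℝ → ℂ} (h : IsTestFunction c d φ) {x : ℝ}
    (hx : x ∉ Ioo c d) : φ x = 0 :=
  image_eq_zero_of_notMem_tsupport fun hx' => hx (h.support hx')

theorem IsTestFunction.differentiable {c d : ℝ} {φ : ℝ → ℂ} (h : IsTestFunction c d φ) :
    Differentiable ℝ φ := h.smooth.differentiable (by simp)

theorem IsTestFunction.continuous {c d : ℝ} {φ : ℝ → ℂ} (h : IsTestFunction c d φ) :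
    Continuous φ := h.smooth.continuous

theorem IsTestFunction.integral_Ioo_mul {c d c' d' : ℝ} {φ : ℝ → ℂ} (h : IsTestFunction c d φ)
    (hc : c' ≤ c) (hd : d ≤ d') (f : ℝ → ℂ) :
    ∫ x in Ioo c' d', f x * φ x = ∫ x in Ioo c d, f x * φ x := by
  refine setIntegral_eq_of_subset_of_forall_sdiff_eq_zero measurableSet_Ioo
    (Ioo_subset_Ioo hc hd) fun x hx => ?_
  rw [h.eq_zero hx.2, mul_zero]

theorem MemL2.integrableOn {c d : ℝ} {f : ℝ → ℂ} (h : MemL2 c d f) : IntegrableOn f (Ioo c d) :=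
  MemLp.integrable (by norm_num) h

theorem MemL2.intervalIntegrable {c d : ℝ} {f : ℝ → ℂ} (h : MemL2 c d f) (hcd : c ≤ d) :
    IntervalIntegrable f volume c d :=
  (intervalIntegrable_iff_integrableOn_Ioo_of_le hcd).2 h.integrableOn

theorem MemL2.mono {c d c' d' : ℝ} {f : ℝ → ℂ} (h : MemL2 c d f) (hc : c ≤ c') (hd : d' ≤ d) :
    MemL2 c' d' f :=
  MemLp.mono_measure (Measure.restrict_mono (Ioo_subset_Ioo hc hd) le_rfl) h

theorem memL2_of_continuousOn {c d : ℝ} {f : ℝ → ℂ} (h : ContinuousOn f (Icc c d)) :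
    MemL2 c d f := by
  obtain ⟨C, hC⟩ := isCompact_Icc.exists_bound_of_continuousOn h
  refine MemLp.of_bound ((h.mono Ioo_subset_Icc_self).aestronglyMeasurable measurableSet_Ioo) C ?_
  filter_upwards [ae_restrict_mem measurableSet_Ioo] with x hx
  exact hC x (Ioo_subset_Icc_self hx)

theorem IsTestFunction.integrableOn_mul {c d p q : ℝ} {φ f : ℝ → ℂ} (h : IsTestFunction p q φ)
    (hf : IntegrableOn f (Ioo c d)) : IntegrableOn (fun x => f x * φ x) (Ioo c d) := by
  obtain ⟨C, hC⟩ := h.compact.exists_bound_of_continuous h.continuous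
  exact Integrable.mul_bdd (c := C) hf h.continuous.aestronglyMeasurable (ae_of_all _ hC)

/-! ### Weak derivatives and primitives. -/

/-- `f` is a primitive of `g` on `[c, d]`. -/
def IsPrimitiveOn (c d : ℝ) (f g : ℝ → ℂ) : Prop :=
  ∀ x ∈ Icc c d, f x = f c + ∫ t in c..x, g t

/-- Since `g` is merely integrable, integration by parts is obtained from Fubini on the triangle
together with `∫ₛᵈ φ' = -φ(s)`. -/
theorem IsPrimitiveOn.hasWeakDeriv {c d : ℝ} (hcd : c ≤ d) {f g : ℝ → ℂ}
    (h : IsPrimitiveOn c d f g) (hg : IntervalIntegrable g volume c d) : HasWeakDeriv c d f g := by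
  intro φ hφ
  have hd : Continuous (deriv φ) := hφ.deriv.continuous
  have hder : ∀ s, ∫ t in s..d, deriv φ t = -φ s := fun s => by
    rw [intervalIntegral.integral_deriv_eq_sub (fun x _ => hφ.differentiable x)
      (hd.intervalIntegrable _ _), hφ.eq_zero (x := d) (by simp), zero_sub]
  have hG : ContinuousOn (fun t => ∫ s in c..t, g s) (Icc c d) := by
    have := intervalIntegral.continuousOn_primitive_interval (a := c) (b := d) (f := g)
      (by rw [uIcc_of_le hcd]; exact (integrableOn_Icc_iff_integrableOn_Ioc).2
            ((intervalIntegrable_iff_integrableOn_Ioc_of_le hcd).1 hg))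
    rwa [uIcc_of_le hcd] at this
  rw [← integral_Ioc_eq_integral_Ioo, ← integral_Ioc_eq_integral_Ioo,
    ← intervalIntegral.integral_of_le hcd, ← intervalIntegral.integral_of_le hcd]
  have e1 : ∫ x in c..d, f x * deriv φ x
      = ∫ t in c..d, (f c * deriv φ t + ∫ s in c..t, deriv φ t * g s) := by
    refine intervalIntegral.integral_congr fun x hx => ?_
    rw [uIcc_of_le hcd] at hx
    simp only [intervalIntegral.integral_const_mul]
    rw [h x hx]; ring
  rw [e1, intervalIntegral.integral_add, intervalIntegral.integral_const_mul, hder,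
    hφ.eq_zero (x := c) (by simp),
    integral_triangle_swap (Φ := fun t _ => deriv φ t) (by exact hd.comp continuous_fst) hcd hg]
  · simp only [hder, neg_zero, mul_zero, zero_add]
    rw [← intervalIntegral.integral_neg]
    exact intervalIntegral.integral_congr fun x _ => by ring
  · exact (hd.intervalIntegrable _ _).const_mul _
  · simp only [intervalIntegral.integral_const_mul]
    refine ContinuousOn.intervalIntegrable ?_
    rw [uIcc_of_le hcd]
    exact hd.continuousOn.mul hG

/-- Real test functions, viewed as complex-valued ones, already suffice for the fundamental lemma of
the calculus of variations. -/
theorem ae_eq_zero_of_forall_test {c d : ℝ} {f : ℝ → ℂ} (hf : IntegrableOn f (Ioo c d))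
    (h : ∀ φ, IsTestFunction c d φ → ∫ x in Ioo c d, f x * φ x = 0) :
    ∀ᵐ x ∂(volume.restrict (Ioo c d)), f x = 0 := by
  rw [ae_restrict_iff' measurableSet_Ioo]
  refine IsOpen.ae_eq_zero_of_integral_contDiff_smul_eq_zero isOpen_Ioo
    hf.locallyIntegrableOn fun g hg hgc hgs => ?_
  have ht : IsTestFunction c d (fun x => (g x : ℂ)) :=
    { smooth := Complex.ofRealCLM.contDiff.comp hg
      compact := hgc.comp_left (g := fun r : ℝ => (r : ℂ)) (by simp)
      support := (closure_mono (t := Function.support g)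
        (fun x hx => by simpa using hx)).trans hgs }
  have := h _ ht
  rw [← this]
  rw [← setIntegral_eq_integral_of_forall_compl_eq_zero (s := Ioo c d)]
  · refine integral_congr_ae (ae_of_all _ fun x => ?_)
    simp [mul_comm]
  · intro x hx
    have := ht.eq_zero hx
    simp only [Complex.ofReal_eq_zero] at this
    simp [this]

theorem exists_testFunction_integral_eq_one {c d : ℝ} (hcd : c < d) :
    ∃ η, IsTestFunction c d η ∧ ∫ x in Ioo c d, η x = 1 := by
  let b : ContDiffBump ((c + d) / 2) := ⟨(d - c) / 8, (d - c) / 4, by linarith, by linarith⟩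
  have hs : tsupport (fun x => (b.normed volume x : ℂ)) ⊆ Ioo c d := by
    refine (closure_mono (t := Function.support (b.normed volume))
      (fun x hx => by simpa using hx)).trans ?_
    rw [← tsupport, b.tsupport_normed_eq, Real.closedBall_eq_Icc]
    exact Icc_subset_Ioo (by simp only [b]; linarith) (by simp only [b]; linarith)
  have ht : IsTestFunction c d (fun x => (b.normed volume x : ℂ)) :=
    { smooth := Complex.ofRealCLM.contDiff.comp b.contDiff_normed
      compact := b.hasCompactSupport_normed.comp_left (g := fun r : ℝ => (r : ℂ)) (by simp)
      support := hs }
  refine ⟨_, ht, ?_⟩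
  rw [setIntegral_eq_integral_of_forall_compl_eq_zero fun x hx => ht.eq_zero hx,
    integral_complex_ofReal, b.integral_normed]
  simp

theorem IsTestFunction.exists_Icc {c d : ℝ} (hcd : c < d) {φ : ℝ → ℂ} (h : IsTestFunction c d φ) :
    ∃ p q, c < p ∧ p ≤ q ∧ q < d ∧ tsupport φ ⊆ Icc p q := by
  rcases (tsupport φ).eq_empty_or_nonempty with he | hne
  · exact ⟨(c + d) / 2, (c + d) / 2, by linarith, le_rfl, by linarith, by simp [he]⟩
  · have hp := h.support (h.compact.isCompact.sInf_mem hne)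
    have hq := h.support (h.compact.isCompact.sSup_mem hne)
    have hb := h.compact.isCompact.bddBelow
    have ha := h.compact.isCompact.bddAbove
    exact ⟨_, _, hp.1, csInf_le_csSup hne hb ha, hq.2, fun x hx => ⟨csInf_le hb hx, le_csSup ha hx⟩⟩

/-- To the left of the support the primitive vanishes trivially, to the right because the mean is
zero; hence it is again compactly supported in the open interval. -/
theorem IsTestFunction.primitive {c d : ℝ} (hcd : c < d) {χ : ℝ → ℂ} (h : IsTestFunction c d χ)
    (h0 : ∫ x in c..d, χ x = 0) :
    IsTestFunction c d (fun x => ∫ t in c..x, χ t) ∧ _root_.deriv (fun x => ∫ t in c..x, χ t) = χ := by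
  have hder : ∀ x, HasDerivAt (fun x => ∫ t in c..x, χ t) (χ x) x := fun x =>
    h.continuous.integral_hasStrictDerivAt c x |>.hasDerivAt
  have hd : _root_.deriv (fun x => ∫ t in c..x, χ t) = χ := funext fun x => (hder x).deriv
  obtain ⟨p, q, hcp, hpq, hqd, hs⟩ := h.exists_Icc hcd
  have hz : ∀ x, x ∉ Icc p q → χ x = 0 := fun x hx =>
    image_eq_zero_of_notMem_tsupport fun hx' => hx (hs hx')
  have hsupp : tsupport (fun x => ∫ t in c..x, χ t) ⊆ Icc p q := by
    refine closure_minimal (fun x hx => ?_) isClosed_Icc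
    by_contra hx'
    apply hx
    rw [mem_Icc, not_and_or, not_le, not_le] at hx'
    rcases hx' with hx' | hx'
    · refine (intervalIntegral.integral_congr (g := fun _ => 0) fun t ht => hz t fun ht' => ?_).trans
        (by simp)
      have := ht.2.trans (max_le hcp.le hx'.le)
      exact absurd (ht.2.trans_lt (max_lt hcp hx')) (not_lt.2 ht'.1)
    · have h2 : ∫ t in x..d, χ t = 0 := by
        refine (intervalIntegral.integral_congr (g := fun _ => 0)
          fun t ht => hz t fun ht' => ?_).trans (by simp)
        exact absurd ((lt_min hx' hqd).trans_le ht.1) (not_lt.2 ht'.2)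
      have := intervalIntegral.integral_add_adjacent_intervals
        (h.continuous.intervalIntegrable (μ := volume) c x) (h.continuous.intervalIntegrable x d)
      rwa [h2, h0, add_zero] at this
  refine ⟨⟨?_, HasCompactSupport.of_support_subset_isCompact isCompact_Icc
    (subset_closure.trans hsupp), hsupp.trans (Icc_subset_Ioo hcp hqd)⟩, hd⟩
  rw [contDiff_infty_iff_deriv, hd]
  exact ⟨fun x => (hder x).differentiableAt, h.smooth⟩

theorem eqOn_Icc_of_ae_eq_Ioo {c d : ℝ} (hcd : c < d) {f g : ℝ → ℂ}
    (hf : ContinuousOn f (Icc c d)) (hg : ContinuousOn g (Icc c d))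
    (h : ∀ᵐ x ∂(volume.restrict (Ioo c d)), f x = g x) : EqOn f g (Icc c d) := by
  have h1 : EqOn f g (Ioo c d) :=
    Measure.eqOn_open_of_ae_eq h isOpen_Ioo (hf.mono Ioo_subset_Icc_self)
      (hg.mono Ioo_subset_Icc_self)
  exact h1.of_subset_closure hf hg Ioo_subset_Icc_self (by rw [closure_Ioo hcd.ne])

/-- The du Bois-Reymond lemma. -/
theorem HasWeakDeriv.isPrimitiveOn {c d : ℝ} (hcd : c < d) {f g : ℝ → ℂ}
    (h : HasWeakDeriv c d f g) (hf : ContinuousOn f (Icc c d)) (hg : IntegrableOn g (Ioo c d)) :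
    IsPrimitiveOn c d f g := by
  have hgi : IntervalIntegrable g volume c d :=
    (intervalIntegrable_iff_integrableOn_Ioo_of_le hcd.le).2 hg
  set G : ℝ → ℂ := fun x => ∫ t in c..x, g t with hGdef
  have hG : ContinuousOn G (Icc c d) := by
    have := intervalIntegral.continuousOn_primitive_interval (a := c) (b := d) (f := g)
      (by rw [uIcc_of_le hcd.le]; exact (integrableOn_Icc_iff_integrableOn_Ioo).2 hg)
    rwa [uIcc_of_le hcd.le] at this
  have hGp : IsPrimitiveOn c d G g := fun x _ => by simp [hGdef]
  have hGw := hGp.hasWeakDeriv hcd.le hgi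
  have hfG : ContinuousOn (fun x => f x - G x) (Icc c d) := hf.sub hG
  have hi {k : ℝ → ℂ} (hk : ContinuousOn k (Icc c d)) : IntegrableOn k (Ioo c d) :=
    (memL2_of_continuousOn hk).integrableOn
  obtain ⟨η, hη, hη1⟩ := exists_testFunction_integral_eq_one hcd
  set κ := ∫ x in Ioo c d, (f x - G x) * η x with hκ
  have hae : ∀ᵐ x ∂(volume.restrict (Ioo c d)), f x - G x - κ = 0 := by
    refine ae_eq_zero_of_forall_test (hi (hfG.sub continuousOn_const)) fun φ hφ => ?_
    set m := ∫ x in Ioo c d, φ x with hm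
    -- Subtracting `m * η` makes the mean zero, so this function is the derivative of a test
    -- function and `f - G`, whose weak derivative is zero, integrates to zero against it. This
    -- forces `f - G` to be the constant `κ`.
    have hχ : IsTestFunction c d (fun x => φ x - m * η x) :=
      { smooth := hφ.smooth.sub (contDiff_const.mul hη.smooth)
        compact := hφ.compact.sub hη.compact.mul_left
        support := by
          refine (closure_minimal (t := tsupport φ ∪ tsupport η) (fun x hx => ?_)
            ((isClosed_tsupport _).union (isClosed_tsupport _))).trans
            (union_subset hφ.support hη.support)
          by_contra hx'
          rw [mem_union, not_or] at hx'
          exact hx (by simp [image_eq_zero_of_notMem_tsupport hx'.1,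
            image_eq_zero_of_notMem_tsupport hx'.2]) }
    have hint {k : ℝ → ℂ} (hk : Continuous k) : IntegrableOn k (Ioo c d) := hi hk.continuousOn
    have h0 : ∫ x in c..d, (φ x - m * η x) = 0 := by
      rw [intervalIntegral.integral_of_le hcd.le, integral_Ioc_eq_integral_Ioo,
        integral_sub (hint hφ.continuous) ((hint hη.continuous).const_mul m),
        integral_const_mul, hη1, ← hm]
      ring
    obtain ⟨hψ, hψ'⟩ := hχ.primitive hcd h0
    have e := h _ hψ
    have e' := hGw _ hψ
    rw [hψ'] at e e'
    have e2 : ∫ x in Ioo c d, (f x - G x) * (φ x - m * η x) = 0 := by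
      simp only [sub_mul (f _)]
      rw [integral_sub (hχ.integrableOn_mul (hi hf)) (hχ.integrableOn_mul (hi hG)), e, e', sub_self]
    have e3 : ∫ x in Ioo c d, (f x - G x) * (φ x - m * η x)
        = (∫ x in Ioo c d, (f x - G x) * φ x) - m * κ := by
      rw [hκ, ← integral_const_mul,
        ← integral_sub (hφ.integrableOn_mul (hi hfG)) ((hη.integrableOn_mul (hi hfG)).const_mul m)]
      exact integral_congr_ae (ae_of_all _ fun x => by ring)
    simp only [sub_mul _ κ]
    rw [integral_sub (hφ.integrableOn_mul (hi hfG)) ((hint hφ.continuous).const_mul κ),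
      integral_const_mul, ← hm, mul_comm κ, ← e3, e2]
  have heq := eqOn_Icc_of_ae_eq_Ioo hcd hfG (continuousOn_const (c := κ))
    (hae.mono fun x hx => sub_eq_zero.1 hx)
  intro x hx
  have h1 := heq hx
  have h2 := heq (left_mem_Icc.2 hcd.le)
  simp only [hGdef, intervalIntegral.integral_same, sub_zero] at h1 h2
  rw [h2, ← h1]; ring

theorem IsPrimitiveOn.hasDerivWithinAt {c d : ℝ} {f g : ℝ → ℂ} (h : IsPrimitiveOn c d f g)
    (hg : ContinuousOn g (Icc c d)) {x : ℝ} (hx : x ∈ Icc c d) :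
    HasDerivWithinAt f (g x) (Icc c d) x := by
  have hcx : IntervalIntegrable g volume c x :=
    (hg.mono (by rw [uIcc_of_le hx.1]; exact Icc_subset_Icc_right hx.2)).intervalIntegrable
  have : Fact (x ∈ Icc c d) := ⟨hx⟩
  have h1 : HasDerivWithinAt (fun y => ∫ t in c..y, g t) (g x) (Icc c d) x :=
    intervalIntegral.integral_hasDerivWithinAt_right hcx
      (hg.stronglyMeasurableAtFilter_nhdsWithin measurableSet_Icc x) (hg x hx)
  exact (h1.const_add (f c)).congr (fun y hy => h y hy) (h x hx)

theorem IsPrimitiveOn.congr_ae {c d : ℝ} {f g h : ℝ → ℂ} (H : IsPrimitiveOn c d f g)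
    (hgh : ∀ᵐ x ∂(volume.restrict (Ioo c d)), g x = h x) : IsPrimitiveOn c d f h := by
  intro x hx
  rw [H x hx, intervalIntegral.integral_of_le hx.1, intervalIntegral.integral_of_le hx.1,
    integral_Ioc_eq_integral_Ioo, integral_Ioc_eq_integral_Ioo]
  congr 1
  exact integral_congr_ae (ae_mono (Measure.restrict_mono (Ioo_subset_Ioo_right hx.2) le_rfl) hgh)

theorem IsPrimitiveOn.continuousOn {c d : ℝ} (hcd : c ≤ d) {f g : ℝ → ℂ}
    (H : IsPrimitiveOn c d f g) (hg : IntervalIntegrable g volume c d) :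
    ContinuousOn f (Icc c d) := by
  have := intervalIntegral.continuousOn_primitive_interval (a := c) (b := d) (f := g)
      (by rw [uIcc_of_le hcd]; exact (integrableOn_Icc_iff_integrableOn_Ioc).2
            ((intervalIntegrable_iff_integrableOn_Ioc_of_le hcd).1 hg))
  rw [uIcc_of_le hcd] at this
  exact (continuousOn_const.add this).congr H

theorem isPrimitiveOn_of_hasDerivAt {f g : ℝ → ℂ} (h : ∀ x, HasDerivAt f (g x) x)
    (hg : Continuous g) (c d : ℝ) : IsPrimitiveOn c d f g := fun x _ => by
  rw [intervalIntegral.integral_eq_sub_of_hasDerivAt (fun y _ => h y) (hg.intervalIntegrable _ _)]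
  ring

/-! ### Chains of primitives and uniqueness for the initial value problem. -/

/-- `D 0, …, D m` are successive derivatives on `[c, d]`, each `D j` with `j < m` being continuous
and the integral of the next one. -/
structure IsPrimitiveChain (m : ℕ) (c d : ℝ) (D : ℕ → ℝ → ℂ) : Prop where
  cont : ∀ j, j < m → ContinuousOn (D j) (Icc c d)
  top : MemL2 c d (D m)
  prim : ∀ j, j < m → IsPrimitiveOn c d (D j) (D (j + 1))

namespace IsPrimitiveChain

variable {m : ℕ} {c d : ℝ} {D E : ℕ → ℝ → ℂ}

theorem memL2 (h : IsPrimitiveChain m c d D) {j : ℕ} (hj : j ≤ m) : MemL2 c d (D j) := by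
  rcases hj.lt_or_eq with hj | rfl
  · exact memL2_of_continuousOn (h.cont j hj)
  · exact h.top

theorem isSobolevDerivs (h : IsPrimitiveChain m c d D) (hcd : c ≤ d) {u : ℝ → ℂ}
    (h0 : ∀ x ∈ Icc c d, D 0 x = u x) : IsSobolevDerivs m c d u D where
  zero := h0
  cont := h.cont
  memL2 _ hj := h.memL2 hj
  deriv j hj := (h.prim j hj).hasWeakDeriv hcd ((h.memL2 hj).intervalIntegrable hcd)

theorem of_isSobolevDerivs {u : ℝ → ℂ} (h : IsSobolevDerivs m c d u D) (hcd : c < d) :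
    IsPrimitiveChain m c d D where
  cont := h.cont
  top := h.memL2 m le_rfl
  prim j hj := (h.deriv j hj).isPrimitiveOn hcd (h.cont j hj) (h.memL2 (j + 1) hj).integrableOn

theorem mono (h : IsPrimitiveChain m c d D) {n : ℕ} (hn : n ≤ m) : IsPrimitiveChain n c d D where
  cont j hj := h.cont j (hj.trans_le hn)
  top := h.memL2 hn
  prim j hj := h.prim j (hj.trans_le hn)

theorem add (hD : IsPrimitiveChain m c d D) (hE : IsPrimitiveChain m c d E) (hcd : c ≤ d) :
    IsPrimitiveChain m c d (fun j x => D j x + E j x) where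
  cont j hj := (hD.cont j hj).add (hE.cont j hj)
  top := MemLp.add hD.top hE.top
  prim j hj x hx := by
    have hs : uIcc c x ⊆ uIcc c d := by
      rw [uIcc_of_le hcd, uIcc_of_le hx.1]; exact Icc_subset_Icc_right hx.2
    rw [intervalIntegral.integral_add (((hD.memL2 hj).intervalIntegrable hcd).mono_set hs)
      (((hE.memL2 hj).intervalIntegrable hcd).mono_set hs)]
    simp only []
    rw [hD.prim j hj x hx, hE.prim j hj x hx]
    ring

theorem const_mul (hD : IsPrimitiveChain m c d D) (k : ℂ) :
    IsPrimitiveChain m c d (fun j x => k * D j x) where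
  cont j hj := continuousOn_const.mul (hD.cont j hj)
  top := MemLp.const_mul hD.top k
  prim j hj x hx := by
    rw [intervalIntegral.integral_const_mul]
    simp only []
    rw [hD.prim j hj x hx]
    ring

theorem sub (hD : IsPrimitiveChain m c d D) (hE : IsPrimitiveChain m c d E) (hcd : c ≤ d) :
    IsPrimitiveChain m c d (fun j x => D j x - E j x) := by
  simpa [sub_eq_add_neg] using hD.add (hE.const_mul (-1)) hcd

theorem restrict (hD : IsPrimitiveChain m c d D) (hcd : c ≤ d) {c' d' : ℝ} (hc : c ≤ c')
    (hcd' : c' ≤ d') (hd : d' ≤ d) : IsPrimitiveChain m c' d' D where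
  cont j hj := (hD.cont j hj).mono (Icc_subset_Icc hc hd)
  top := hD.top.mono hc hd
  prim j hj x hx := by
    have hi {y : ℝ} (hy : c ≤ y) (hy' : y ≤ d) : IntervalIntegrable (D (j + 1)) volume c y :=
      ((hD.memL2 hj).intervalIntegrable hcd).mono_set (by
        rw [uIcc_of_le hcd, uIcc_of_le hy]; exact Icc_subset_Icc_right hy')
    have h1 := hD.prim j hj x ⟨hc.trans hx.1, hx.2.trans hd⟩
    have h2 := hD.prim j hj c' ⟨hc, hcd'.trans hd⟩
    rw [h1, h2, add_assoc, intervalIntegral.integral_add_adjacent_intervals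
      (hi hc (hcd'.trans hd))
      ((hi hc (hcd'.trans hd)).symm.trans (hi (hc.trans hx.1) (hx.2.trans hd)))]

theorem of_hasDerivAt (h : ∀ j x, HasDerivAt (D j) (D (j + 1) x) x) (m : ℕ) (c d : ℝ) :
    IsPrimitiveChain m c d D := by
  have hc : ∀ j, Continuous (D j) := fun j =>
    continuous_iff_continuousAt.2 fun x => (h j x).continuousAt
  exact ⟨fun j _ => (hc j).continuousOn, memL2_of_continuousOn (hc m).continuousOn,
    fun j _ => isPrimitiveOn_of_hasDerivAt (h j) (hc _) c d⟩

/-- Below the top order the entries are one-sided classical derivatives, hence determined by the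
function. This identifies traces computed from different Sobolev representations. -/
theorem deriv_eq (hD : IsPrimitiveChain m c d D) (hE : IsPrimitiveChain m c d E) (hcd : c < d)
    (h0 : EqOn (D 0) (E 0) (Icc c d)) {j : ℕ} (hj : j < m) : EqOn (D j) (E j) (Icc c d) := by
  induction j with
  | zero => exact h0
  | succ j ih =>
    intro x hx
    have h1 := (hD.prim j (by omega)).hasDerivWithinAt (hD.cont _ hj) hx
    have h2 := ((hE.prim j (by omega)).hasDerivWithinAt (hE.cont _ hj) hx).congr
      (ih (by omega)) (ih (by omega) hx)
    exact (uniqueDiffOn_Icc hcd x hx).eq_deriv _ h1 h2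

/-- Uniqueness for the initial value problem `e'''' = κ e`. -/
theorem eq_zero_of_fourth {e : ℕ → ℝ → ℂ} (h : IsPrimitiveChain 4 c d e) (κ : ℂ)
    (h4 : ∀ᵐ x ∂(volume.restrict (Ioo c d)), e 4 x = κ * e 0 x)
    (hc : ∀ j, j < 4 → e j c = 0) {j : ℕ} (hj : j < 4) {x : ℝ} (hx : x ∈ Icc c d) :
    e j x = 0 := by
  -- The entry `e 4` is only square-integrable, but it agrees almost everywhere with a continuous
  -- function, so `e 3` is classically differentiable.
  have hp3 : IsPrimitiveOn c d (e 3) (fun x => κ * e 0 x) := (h.prim 3 (by norm_num)).congr_ae h4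
  have hd (i : ℕ) (hi : i < 3) {t : ℝ} (ht : t ∈ Icc c d) :=
    (h.prim i (by omega)).hasDerivWithinAt (h.cont (i + 1) (by omega)) ht
  have hd3 {t : ℝ} (ht : t ∈ Icc c d) :=
    hp3.hasDerivWithinAt (continuousOn_const.mul (h.cont 0 (by norm_num))) ht
  -- Companion map of the equation: the vector of `e` and its first three derivatives solves a
  -- linear, hence Lipschitz, first-order system.
  let L : (ℂ × ℂ × ℂ × ℂ) →L[ℝ] (ℂ × ℂ × ℂ × ℂ) := LinearMap.toContinuousLinearMap
    { toFun := fun p => (p.2.1, p.2.2.1, p.2.2.2, κ * p.1)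
      map_add' := fun p q => by simp [mul_add]
      map_smul' := fun r p => by simp [mul_left_comm] }
  have hL (p : ℂ × ℂ × ℂ × ℂ) : L p = (p.2.1, p.2.2.1, p.2.2.2, κ * p.1) := rfl
  let y : ℝ → ℂ × ℂ × ℂ × ℂ := fun t => (e 0 t, e 1 t, e 2 t, e 3 t)
  have hy : ∀ t ∈ Icc c d, HasDerivWithinAt y (L (y t)) (Icc c d) t := fun t ht =>
    (hd 0 (by norm_num) ht).prodMk ((hd 1 (by norm_num) ht).prodMk
      ((hd 2 (by norm_num) ht).prodMk (hd3 ht)))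
  have key : EqOn y (fun _ => 0) (Icc c d) := by
    refine ODE_solution_unique_of_mem_Icc_right (v := fun _ => L) (s := fun _ => univ)
      (K := ‖L‖₊) (fun t _ => L.lipschitz.lipschitzOnWith) (fun t ht => (hy t ht).continuousWithinAt)
      (fun t ht => (hy t (Ico_subset_Icc_self ht)).mono_of_mem_nhdsWithin ?_) (fun _ _ => mem_univ _)
      continuousOn_const (fun t _ => ?_) (fun _ _ => mem_univ _) ?_
    · exact mem_of_superset (Icc_mem_nhdsGE ht.2) (Icc_subset_Icc_left ht.1)
    · simpa using hasDerivWithinAt_const t (Ici t) (0 : ℂ × ℂ × ℂ × ℂ)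
    · simp [y, hc]
  have := key hx
  simp only [y, Prod.mk_eq_zero] at this
  interval_cases j <;> simp [this]

end IsPrimitiveChain

/-- Iterated integration by parts against a test function. -/
theorem IsSobolevDerivs.integral_mul_iteratedDeriv {m : ℕ} {c d : ℝ} {u : ℝ → ℂ}
    {D : ℕ → ℝ → ℂ} (h : IsSobolevDerivs m c d u D) {φ : ℝ → ℂ} (hφ : IsTestFunction c d φ) {n : ℕ}
    (hn : n ≤ m) :
    ∫ x in Ioo c d, u x * iteratedDeriv n φ x = (-1) ^ n * ∫ x in Ioo c d, D n x * φ x := by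
  have key : ∫ x in Ioo c d, D 0 x * iteratedDeriv n φ x
      = (-1) ^ n * ∫ x in Ioo c d, D n x * φ x := by
    induction n generalizing φ with
    | zero => simp
    | succ n ih =>
      rw [iteratedDeriv_succ', ih hφ.deriv (by omega), h.deriv n (by omega) φ hφ, pow_succ]
      ring
  rw [← key]
  refine setIntegral_congr_fun measurableSet_Ioo fun x hx => ?_
  simp only [h.zero x (Ioo_subset_Icc_self hx)]

/-! ### The fundamental solution and its derivatives. -/

/-- The derivatives of `(sinh (λ x) - sin (λ x)) / (2 a λ³)`. -/
def kernel (a : ℝ) (lam : ℂ) : ℕ → ℝ → ℂ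
  | 0 => fun x => 1 / (2 * a * lam ^ 3) * (Complex.sinh (lam * x) - Complex.sin (lam * x))
  | 1 => fun x => 1 / (2 * a * lam ^ 2) * (Complex.cosh (lam * x) - Complex.cos (lam * x))
  | 2 => fun x => 1 / (2 * a * lam) * (Complex.sinh (lam * x) + Complex.sin (lam * x))
  | 3 => fun x => 1 / (2 * a) * (Complex.cosh (lam * x) + Complex.cos (lam * x))
  | n + 4 => fun x => lam ^ 4 * kernel a lam n x

theorem hasDerivAt_kernel (a : ℝ) {lam : ℂ} (hl : lam ≠ 0) :
    ∀ (n : ℕ) (x : ℝ), HasDerivAt (kernel a lam n) (kernel a lam (n + 1) x) x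
  | 0, x => by
    have hx : HasDerivAt (fun z : ℂ => lam * z) lam x := by
      simpa using (hasDerivAt_id (x : ℂ)).const_mul lam
    refine HasDerivAt.congr_deriv (HasDerivAt.comp_ofReal
      ((hx.csinh.sub hx.csin).const_mul (1 / (2 * a * lam ^ 3) : ℂ))) ?_
    simp only [kernel]; field_simp
  | 1, x => by
    have hx : HasDerivAt (fun z : ℂ => lam * z) lam x := by
      simpa using (hasDerivAt_id (x : ℂ)).const_mul lam
    refine HasDerivAt.congr_deriv (HasDerivAt.comp_ofReal
      ((hx.ccosh.sub hx.ccos).const_mul (1 / (2 * a * lam ^ 2) : ℂ))) ?_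
    simp only [kernel]; field_simp; ring
  | 2, x => by
    have hx : HasDerivAt (fun z : ℂ => lam * z) lam x := by
      simpa using (hasDerivAt_id (x : ℂ)).const_mul lam
    refine HasDerivAt.congr_deriv (HasDerivAt.comp_ofReal
      ((hx.csinh.add hx.csin).const_mul (1 / (2 * a * lam) : ℂ))) ?_
    simp only [kernel]; field_simp
  | 3, x => by
    have hx : HasDerivAt (fun z : ℂ => lam * z) lam x := by
      simpa using (hasDerivAt_id (x : ℂ)).const_mul lam
    refine HasDerivAt.congr_deriv (HasDerivAt.comp_ofReal
      ((hx.ccosh.add hx.ccos).const_mul (1 / (2 * a) : ℂ))) ?_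
    simp only [kernel]; field_simp; ring
  | n + 4, x => (hasDerivAt_kernel a hl n x).const_mul (lam ^ 4)

theorem kernel_zero (a : ℝ) (lam : ℂ) {n : ℕ} (hn : n < 3) : kernel a lam n 0 = 0 := by
  interval_cases n <;> simp [kernel]

theorem kernel_three_zero {a : ℝ} (ha : a ≠ 0) (lam : ℂ) : kernel a lam 3 0 = 1 / a := by
  have : (a : ℂ) ≠ 0 := by exact_mod_cast ha
  simp [kernel]; field_simp; norm_num

theorem kernel_add_four (a : ℝ) (lam : ℂ) (n : ℕ) (x : ℝ) :
    kernel a lam (n + 4) x = lam ^ 4 * kernel a lam n x := rfl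

theorem continuous_kernel (a : ℝ) {lam : ℂ} (hl : lam ≠ 0) (n : ℕ) :
    Continuous (kernel a lam n) :=
  continuous_iff_continuousAt.2 fun x => (hasDerivAt_kernel a hl n x).continuousAt

theorem u0_eq (a : ℝ) (lam : ℂ) (x : ℝ) : u0 a lam x = kernel a lam 0 x * heaviside x := rfl

/-- At the origin `k` is `o(x)`, and the cutoff can only decrease its modulus. Applied twice, this
computes the second derivative of `u₀` on the whole line. -/
theorem hasDerivAt_mul_heaviside {k k' : ℝ → ℂ} (hk : ∀ x, HasDerivAt k (k' x) x) (h0 : k 0 = 0)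
    (h0' : k' 0 = 0) (x : ℝ) :
    HasDerivAt (fun x => k x * heaviside x) (k' x * heaviside x) x := by
  rcases lt_trichotomy x 0 with hx | rfl | hx
  · have : (fun x => k x * heaviside x) =ᶠ[𝓝 x] fun _ => 0 := by
      filter_upwards [Iio_mem_nhds hx] with y hy
      simp [heaviside, not_le.2 (mem_Iio.1 hy)]
    rw [heaviside, if_neg (not_le.2 hx), mul_zero]
    exact (hasDerivAt_const x (0 : ℂ)).congr_of_eventuallyEq this
  · rw [h0', zero_mul]
    have h := hk 0
    rw [h0', hasDerivAt_iff_isLittleO] at h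
    rw [hasDerivAt_iff_isLittleO]
    refine Asymptotics.IsBigO.trans_isLittleO (Asymptotics.IsBigO.of_bound 1 ?_) h
    refine Eventually.of_forall fun y => ?_
    simp only [h0, smul_zero, sub_zero, zero_mul, one_mul, heaviside]
    split_ifs <;> simp
  · have : (fun x => k x * heaviside x) =ᶠ[𝓝 x] k := by
      filter_upwards [Ioi_mem_nhds hx] with y hy
      simp [heaviside, (le_of_lt hy : (0 : ℝ) ≤ y)]
    rw [heaviside, if_pos hx.le, mul_one]
    exact (hk x).congr_of_eventuallyEq this

theorem u0xx_eq (a : ℝ) {lam : ℂ} (hl : lam ≠ 0) (x : ℝ) :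
    u0xx a lam x = kernel a lam 2 x * heaviside x := by
  have h0 : deriv (u0 a lam) = fun x => kernel a lam 1 x * heaviside x := funext fun x =>
    (hasDerivAt_mul_heaviside (hasDerivAt_kernel a hl 0) (kernel_zero a lam (by norm_num))
      (kernel_zero a lam (by norm_num)) x).deriv
  rw [u0xx, iteratedDeriv_succ, iteratedDeriv_one, h0]
  exact (hasDerivAt_mul_heaviside (hasDerivAt_kernel a hl 1) (kernel_zero a lam (by norm_num))
      (kernel_zero a lam (by norm_num)) x).deriv

theorem u0_of_nonneg (a : ℝ) (lam : ℂ) {x : ℝ} (hx : 0 ≤ x) : u0 a lam x = kernel a lam 0 x := by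
  rw [u0_eq, heaviside, if_pos hx, mul_one]

theorem u0_of_nonpos (a : ℝ) (lam : ℂ) {x : ℝ} (hx : x ≤ 0) : u0 a lam x = 0 := by
  rcases hx.lt_or_eq with hx | rfl
  · rw [u0_eq, heaviside, if_neg (not_le.2 hx), mul_zero]
  · rw [u0_eq, kernel_zero a lam (by norm_num), zero_mul]

theorem u0xx_of_nonneg (a : ℝ) {lam : ℂ} (hl : lam ≠ 0) {x : ℝ} (hx : 0 ≤ x) :
    u0xx a lam x = kernel a lam 2 x := by
  rw [u0xx_eq a hl, heaviside, if_pos hx, mul_one]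

/-- Here `k'` may be nonzero at the origin, so the step from the second to the third derivative of
`u₀`, where a jump appears, is covered too. -/
theorem isPrimitiveOn_shift_heaviside {k k' : ℝ → ℂ} (hk : ∀ x, HasDerivAt k (k' x) x)
    (hk' : Continuous k') (h0 : k 0 = 0) {ξ c : ℝ} (hc : c ≤ ξ) (d : ℝ) :
    IsPrimitiveOn c d (fun x => k (x - ξ) * heaviside (x - ξ))
      (fun x => k' (x - ξ) * heaviside (x - ξ)) := by
  have hz {x : ℝ} (hx : x ≤ ξ) : k (x - ξ) * heaviside (x - ξ) = 0 := by
    rcases hx.lt_or_eq with hx | rfl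
    · simp [heaviside, hx]
    · simp [h0]
  have hz' {x : ℝ} (hx : x ≤ ξ) : ∫ t in c..x, k' (t - ξ) * heaviside (t - ξ) = 0 := by
    rw [← intervalIntegral.integral_zero (a := c) (b := x) (μ := volume)]
    refine intervalIntegral.integral_congr_ae ?_
    -- The point `ξ` has to be discarded because `heaviside 0 = 1` and `k' 0` may be nonzero.
    have hne : ∀ᵐ t : ℝ, t ≠ ξ := Measure.ae_ne volume ξ
    filter_upwards [hne] with t ht hts
    have : t ≤ ξ := hts.2.trans (max_le hc hx)
    simp [heaviside, this.lt_of_ne ht]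
  have hI {x : ℝ} (hx : ξ ≤ x) : ∫ t in ξ..x, k' (t - ξ) * heaviside (t - ξ) = k (x - ξ) := by
    have e : ∫ t in ξ..x, k' (t - ξ) * heaviside (t - ξ) = ∫ t in ξ..x, k' (t - ξ) := by
      refine intervalIntegral.integral_congr fun t ht => ?_
      rw [uIcc_of_le hx] at ht
      simp [heaviside, ht.1]
    rw [e, intervalIntegral.integral_eq_sub_of_hasDerivAt (f := fun t => k (t - ξ))
      (fun t _ => (hk (t - ξ)).comp_sub_const t ξ)
      ((hk'.comp (continuous_id.sub continuous_const)).intervalIntegrable _ _)]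
    simp [h0]
  have hint (p q : ℝ) : IntervalIntegrable (fun t => k' (t - ξ) * heaviside (t - ξ)) volume p q := by
    have h1 : IntervalIntegrable (fun t => k' (t - ξ)) volume p q :=
      (hk'.comp (continuous_id.sub continuous_const)).intervalIntegrable _ _
    have h2 : (fun t => k' (t - ξ) * heaviside (t - ξ)) = (Ici ξ).indicator fun t => k' (t - ξ) := by
      ext t; simp [heaviside, indicator]
    rw [h2, intervalIntegrable_iff]
    exact (intervalIntegrable_iff.1 h1).indicator measurableSet_Ici
  intro x hx
  simp only []
  rw [hz hc, zero_add]
  rcases le_total x ξ with h | h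
  · rw [hz h, hz' h]
  · rw [← intervalIntegral.integral_add_adjacent_intervals (hint c ξ) (hint ξ x), hz' le_rfl, hI h]
    simp [heaviside, h]

/-- The derivatives of `u₀(λ, x - ξ)`. -/
theorem isPrimitiveChain_shift_heaviside (a : ℝ) {lam : ℂ} (hl : lam ≠ 0) {ξ c : ℝ} (hc : c ≤ ξ)
    {d : ℝ} (hcd : c ≤ d) : IsPrimitiveChain 3 c d
      (fun j x => kernel a lam j (x - ξ) * heaviside (x - ξ)) := by
  have hL2 (j : ℕ) : MemL2 c d (fun x => kernel a lam j (x - ξ) * heaviside (x - ξ)) := by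
    have h2 : (fun x => kernel a lam j (x - ξ) * heaviside (x - ξ))
        = (Ici ξ).indicator fun x => kernel a lam j (x - ξ) := by
      ext t; simp [heaviside, indicator]
    rw [h2]
    exact MemLp.indicator measurableSet_Ici (memL2_of_continuousOn
      ((continuous_kernel a hl j).comp (continuous_id.sub continuous_const)).continuousOn)
  have hp (j : ℕ) (hj : j < 3) := isPrimitiveOn_shift_heaviside (hasDerivAt_kernel a hl j)
    (continuous_kernel a hl (j + 1)) (kernel_zero a lam hj) hc d
  exact ⟨fun j hj => (hp j hj).continuousOn hcd ((hL2 (j + 1)).intervalIntegrable hcd), hL2 3, hp⟩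

/-! ### Convolution with the fundamental solution. -/

theorem conv_congr {k k' f : ℝ → ℂ} {x : ℝ} (hx : 0 ≤ x) (h : ∀ y, 0 ≤ y → k y = k' y) :
    conv k f x = conv k' f x := by
  refine intervalIntegral.integral_congr fun s hs => ?_
  rw [uIcc_of_le hx] at hs
  simp only [h (x - s) (by linarith [hs.2])]

theorem conv_u0 (a : ℝ) (lam : ℂ) (f : ℝ → ℂ) {x : ℝ} (hx : 0 ≤ x) :
    conv (u0 a lam) f x = conv (kernel a lam 0) f x :=
  conv_congr hx fun _ => u0_of_nonneg a lam

theorem conv_zero (k f : ℝ → ℂ) : conv k f 0 = 0 := by simp [conv]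

theorem intervalIntegrable_indicator {f : ℝ → ℂ} (hf : IntegrableOn f (Ioo 0 1)) (c d : ℝ) :
    IntervalIntegrable ((Icc (0 : ℝ) 1).indicator f) volume c d :=
  Integrable.intervalIntegrable
    ((integrable_indicator_iff measurableSet_Icc).2 ((integrableOn_Icc_iff_integrableOn_Ioo).2 hf))

/-- Integrated form of `(k ⋆ f)' = k(0) f + k' ⋆ f`, valid for merely integrable `f` by exchanging
the order of integration. The endpoint `d` may exceed 1 because `f` is extended by zero. -/
theorem isPrimitiveOn_conv {k k' f : ℝ → ℂ} (hk : ∀ x, HasDerivAt k (k' x) x)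
    (hk' : Continuous k') (hf : IntegrableOn f (Ioo 0 1)) (d : ℝ) :
    IsPrimitiveOn 0 d (conv k f)
      (fun t => k 0 * (Icc (0 : ℝ) 1).indicator f t + conv k' f t) := by
  intro x hx
  have hΦ : Continuous (Function.uncurry fun t s => k' (t - s)) :=
    hk'.comp (continuous_fst.sub continuous_snd)
  have hkc : Continuous k := continuous_iff_continuousAt.2 fun y => (hk y).continuousAt
  have hfi := intervalIntegrable_indicator hf 0 x
  have hi := intervalIntegrable_triangle hΦ hx.1 hfi
  have e0 : ∫ t in (0 : ℝ)..x, (k 0 * (Icc (0 : ℝ) 1).indicator f t + conv k' f t)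
      = (∫ t in (0 : ℝ)..x, k 0 * (Icc (0 : ℝ) 1).indicator f t) + ∫ t in (0 : ℝ)..x, conv k' f t :=
    intervalIntegral.integral_add (hfi.const_mul _) hi
  have e : ∫ t in (0 : ℝ)..x, conv k' f t
      = ∫ s in (0 : ℝ)..x, (k (x - s) - k 0) * (Icc (0 : ℝ) 1).indicator f s := by
    refine (integral_triangle_swap hΦ hx.1 hfi).trans
      (intervalIntegral.integral_congr fun s _ => ?_)
    rw [intervalIntegral.integral_eq_sub_of_hasDerivAt (f := fun t => k (t - s))
      (fun t _ => (hk (t - s)).comp_sub_const t s)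
      ((hk'.comp (continuous_id.sub continuous_const)).intervalIntegrable _ _), sub_self]
  rw [e0, e, conv_zero, zero_add, ← intervalIntegral.integral_add (hfi.const_mul _)]
  · exact intervalIntegral.integral_congr fun s _ => by ring
  · exact hfi.continuousOn_mul (Continuous.continuousOn (by fun_prop))

theorem continuousOn_conv {k k' f : ℝ → ℂ} (hk : ∀ x, HasDerivAt k (k' x) x)
    (hk' : Continuous k') (hf : IntegrableOn f (Ioo 0 1)) {d : ℝ} (hd : 0 ≤ d) :
    ContinuousOn (conv k f) (Icc 0 d) := by
  have hfi := intervalIntegrable_indicator hf 0 d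
  exact (isPrimitiveOn_conv hk hk' hf d).continuousOn hd ((hfi.const_mul _).add
    (intervalIntegrable_triangle (Φ := fun t s => k' (t - s))
      (hk'.comp (continuous_fst.sub continuous_snd)) hd hfi))

theorem conv_const_mul (c : ℂ) (k f : ℝ → ℂ) (x : ℝ) :
    conv (fun y => c * k y) f x = c * conv k f x := by
  simp only [conv, mul_assoc, intervalIntegral.integral_const_mul]

/-- The derivatives of the particular solution `u₀ ⋆ f` of `a w'''' - a λ⁴ w = f`. -/
def convDeriv (a : ℝ) (lam : ℂ) (f : ℝ → ℂ) : ℕ → ℝ → ℂ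
  -- Only at order four does the boundary term `k(0) f` survive, since `kernel a lam 3 0 = 1 / a`
  -- while the lower kernels vanish at the origin.
  | 4 => fun x => lam ^ 4 * conv (kernel a lam 0) f x + f x / a
  | j => conv (kernel a lam j) f

theorem isPrimitiveOn_conv_kernel (a : ℝ) {lam : ℂ} (hl : lam ≠ 0) {f : ℝ → ℂ}
    (hf : IntegrableOn f (Ioo 0 1)) {j : ℕ} (hj : j < 3) (d : ℝ) :
    IsPrimitiveOn 0 d (conv (kernel a lam j) f) (conv (kernel a lam (j + 1)) f) := by
  simpa [kernel_zero a lam hj] using isPrimitiveOn_conv (hasDerivAt_kernel a hl j)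
    (continuous_kernel a hl (j + 1)) hf d

theorem isPrimitiveChain_convDeriv {a : ℝ} (ha : a ≠ 0) {lam : ℂ} (hl : lam ≠ 0) {f : ℝ → ℂ}
    (hf : MemL2 0 1 f) : IsPrimitiveChain 4 0 1 (convDeriv a lam f) := by
  have hc (j : ℕ) : ContinuousOn (conv (kernel a lam j) f) (Icc 0 1) :=
    continuousOn_conv (hasDerivAt_kernel a hl j) (continuous_kernel a hl (j + 1)) hf.integrableOn
      zero_le_one
  have h3 : IsPrimitiveOn 0 1 (conv (kernel a lam 3) f)
      (fun x => lam ^ 4 * conv (kernel a lam 0) f x + f x / a) := by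
    refine (isPrimitiveOn_conv (hasDerivAt_kernel a hl 3) (continuous_kernel a hl 4)
      hf.integrableOn 1).congr_ae ?_
    filter_upwards [ae_restrict_mem measurableSet_Ioo] with x hx
    rw [indicator_of_mem (Ioo_subset_Icc_self hx), kernel_three_zero ha]
    have : conv (kernel a lam 4) f x = lam ^ 4 * conv (kernel a lam 0) f x :=
      conv_const_mul _ _ _ _
    rw [this]; ring
  refine ⟨fun j hj => ?_, ?_, fun j hj => ?_⟩
  · interval_cases j <;> exact hc _
  · refine MemLp.add (memL2_of_continuousOn (continuousOn_const.mul (hc 0))) ?_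
    simpa [div_eq_inv_mul] using MemLp.const_mul hf (a : ℂ)⁻¹
  · interval_cases j
    · exact isPrimitiveOn_conv_kernel a hl hf.integrableOn (by norm_num) 1
    · exact isPrimitiveOn_conv_kernel a hl hf.integrableOn (by norm_num) 1
    · exact isPrimitiveOn_conv_kernel a hl hf.integrableOn (by norm_num) 1
    · exact h3

theorem iteratedDeriv_two_conv_u0 (a : ℝ) {lam : ℂ} (hl : lam ≠ 0) {f : ℝ → ℂ}
    (hf : MemL2 0 1 f) :
    iteratedDeriv 2 (conv (u0 a lam) f) 1 = conv (kernel a lam 2) f 1 := by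
  -- The interval is taken up to 2 so that the point 1 is interior and two-sided derivatives exist
  -- there.
  have hd {j : ℕ} (hj : j < 3) {x : ℝ} (hx : x ∈ Ioo (0 : ℝ) 2) :
      HasDerivAt (conv (kernel a lam j) f) (conv (kernel a lam (j + 1)) f x) x :=
    ((isPrimitiveOn_conv_kernel a hl hf.integrableOn hj 2).hasDerivWithinAt
      (continuousOn_conv (hasDerivAt_kernel a hl _) (continuous_kernel a hl _) hf.integrableOn
        (by norm_num)) (Ioo_subset_Icc_self hx)).hasDerivAt (Icc_mem_nhds hx.1 hx.2)
  have hU {x : ℝ} (hx : x ∈ Ioo (0 : ℝ) 2) :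
      deriv (conv (u0 a lam) f) x = conv (kernel a lam 1) f x := by
    refine ((hd (j := 0) (by norm_num) hx).congr_of_eventuallyEq ?_).deriv
    filter_upwards [Ioi_mem_nhds hx.1] with y hy
    exact conv_u0 a lam f (le_of_lt hy)
  have h1 : (1 : ℝ) ∈ Ioo (0 : ℝ) 2 := by norm_num
  rw [iteratedDeriv_succ, iteratedDeriv_one]
  refine ((hd (j := 1) (by norm_num) h1).congr_of_eventuallyEq ?_).deriv
  filter_upwards [Ioo_mem_nhds h1.1 h1.2] with y hy
  exact hU hy

/-! ### The linear system for the free parameters. -/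

/-- The linear system for `X = u(ξ)`, `c₁ = u'''(0)` and `c₃ = u'(0)` which expresses the boundary
conditions at `1` and the value at `ξ`. -/
structure IsBoundaryData (a α ξ : ℝ) (μ lam A B C X c₁ c₃ : ℂ) : Prop where
  sinh_eq : Complex.sinh lam * (c₁ + lam ^ 2 * c₃)
      + α * μ / a * Complex.sinh (lam * (ξ - 1)) * X = -(lam * (A + B))
  sin_eq : Complex.sin lam * (lam ^ 2 * c₃ - c₁)
      - α * μ / a * Complex.sin (lam * (ξ - 1)) * X = -(lam * (A - B))
  value_eq : Complex.sinh (lam * ξ) * (c₁ + lam ^ 2 * c₃)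
      + Complex.sin (lam * ξ) * (lam ^ 2 * c₃ - c₁) - 2 * lam ^ 3 * X = -(2 * lam * C)

/-- The numerator of `u'''(0)`. -/
def thirdNumerator (a α ξ : ℝ) (μ lam A B C : ℂ) : ℂ :=
  4 * lam ^ 6 * ((A + B) * Complex.sin lam - (A - B) * Complex.sinh lam)
    + α * Delta1 a ξ μ lam A B C

/-- The numerator of `u'(0)`. -/
def firstNumerator (a α ξ : ℝ) (μ lam A B C : ℂ) : ℂ :=
  4 * lam ^ 4 * ((A - B) * Complex.sinh lam + (A + B) * Complex.sin lam)
    + α * Delta3 a ξ μ lam A B C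

section

variable {a α ξ : ℝ} {μ lam A B C X c₁ c₃ : ℂ}

theorem isBoundaryData_iff_and : IsBoundaryData a α ξ μ lam A B C X c₁ c₃ ↔
    Complex.sinh lam * (c₁ + lam ^ 2 * c₃)
      + α * μ / a * Complex.sinh (lam * (ξ - 1)) * X = -(lam * (A + B)) ∧
    Complex.sin lam * (lam ^ 2 * c₃ - c₁)
      - α * μ / a * Complex.sin (lam * (ξ - 1)) * X = -(lam * (A - B)) ∧
    Complex.sinh (lam * ξ) * (c₁ + lam ^ 2 * c₃)
      + Complex.sin (lam * ξ) * (lam ^ 2 * c₃ - c₁) - 2 * lam ^ 3 * X = -(2 * lam * C) :=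
  ⟨fun h => ⟨h.sinh_eq, h.sin_eq, h.value_eq⟩, fun h => ⟨h.1, h.2.1, h.2.2⟩⟩

/-- In the unknowns `c₁ + λ² c₃`, `λ² c₃ - c₁`, `X` the matrix is sparse; each identity combines the
three equations with the matching cofactors as coefficients, scaled by `4 λ²`. -/
theorem IsBoundaryData.cramer (hl : lam ≠ 0) (h : IsBoundaryData a α ξ μ lam A B C X c₁ c₃) :
    detAlpha a α ξ μ lam * X = Delta0 ξ lam A B C ∧
    detAlpha a α ξ μ lam * c₁ = thirdNumerator a α ξ μ lam A B C ∧
    detAlpha a α ξ μ lam * c₃ = firstNumerator a α ξ μ lam A B C := by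
  obtain ⟨e1, e2, e3⟩ := h
  unfold detAlpha Delta0 thirdNumerator firstNumerator Delta1 Delta3
  generalize Complex.sinh lam = S at *
  generalize Complex.sin lam = s at *
  generalize Complex.sinh (lam * ξ) = P at *
  generalize Complex.sin (lam * ξ) = p at *
  generalize Complex.sinh (lam * (ξ - 1)) = Q at *
  generalize Complex.sin (lam * (ξ - 1)) = q at *
  have ey : 4 * lam ^ 2 * ((-2 * lam ^ 3 * S - α * (μ / a) * P * Q) * s + α * (μ / a) * p * S * q)
      * (c₁ + lam ^ 2 * c₃) = 4 * lam ^ 2 * ((-2 * lam ^ 3 * s + α * (μ / a) * q * p) * -(lam * (A + B))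
        + α * (μ / a) * Q * p * -(lam * (A - B)) + -(α * (μ / a) * Q * s) * -(2 * lam * C)) := by
    linear_combination 4 * lam ^ 2 * ((-2 * lam ^ 3 * s + α * (μ / a) * q * p) * e1
      + α * (μ / a) * Q * p * e2 - α * (μ / a) * Q * s * e3)
  have ew : 4 * lam ^ 2 * ((-2 * lam ^ 3 * S - α * (μ / a) * P * Q) * s + α * (μ / a) * p * S * q)
      * (lam ^ 2 * c₃ - c₁) = 4 * lam ^ 2 * (-(α * (μ / a) * q * P) * -(lam * (A + B))
        + (-2 * lam ^ 3 * S - α * (μ / a) * Q * P) * -(lam * (A - B)) + S * (α * (μ / a) * q) * -(2 * lam * C)) := by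
    linear_combination 4 * lam ^ 2 * (-(α * (μ / a) * q * P) * e1
      + (-2 * lam ^ 3 * S - α * (μ / a) * Q * P) * e2 + S * (α * (μ / a) * q) * e3)
  have hl2 : 2 * lam ^ 2 ≠ 0 := by simpa using hl
  refine ⟨?_, ?_, ?_⟩
  · linear_combination 4 * lam ^ 2 * (-(s * P) * e1 - S * p * e2 + S * s * e3)
  · linear_combination (ey - ew) / 2
  -- The two combined unknowns add up to `2 λ² c₃`, so this factor is cancelled.
  · refine mul_left_cancel₀ hl2 ?_
    linear_combination ey + ew

theorem isBoundaryData_of_det_ne_zero (hD : detAlpha a α ξ μ lam ≠ 0) (A B C : ℂ) :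
    IsBoundaryData a α ξ μ lam A B C (Delta0 ξ lam A B C / detAlpha a α ξ μ lam)
      (thirdNumerator a α ξ μ lam A B C / detAlpha a α ξ μ lam)
      (firstNumerator a α ξ μ lam A B C / detAlpha a α ξ μ lam) := by
  -- All three candidates have the same denominator, so each equation reduces to a polynomial
  -- identity between numerators.
  have key : ∀ {p q r s : ℂ}, p * thirdNumerator a α ξ μ lam A B C
      + q * firstNumerator a α ξ μ lam A B C + r * Delta0 ξ lam A B C
      = s * detAlpha a α ξ μ lam →
      p * (thirdNumerator a α ξ μ lam A B C / detAlpha a α ξ μ lam)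
      + q * (firstNumerator a α ξ μ lam A B C / detAlpha a α ξ μ lam)
      + r * (Delta0 ξ lam A B C / detAlpha a α ξ μ lam) = s := by
    intro p q r s h
    field_simp
    linear_combination h
  refine ⟨?_, ?_, ?_⟩
  · refine Eq.trans ?_ (key (p := Complex.sinh lam) (q := Complex.sinh lam * lam ^ 2)
      (r := α * μ / a * Complex.sinh (lam * (ξ - 1))) ?_)
    · ring
    · unfold detAlpha Delta0 thirdNumerator firstNumerator Delta1 Delta3
      ring
  · refine Eq.trans ?_ (key (p := -Complex.sin lam) (q := Complex.sin lam * lam ^ 2)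
      (r := -(α * μ / a * Complex.sin (lam * (ξ - 1)))) ?_)
    · ring
    · unfold detAlpha Delta0 thirdNumerator firstNumerator Delta1 Delta3
      ring
  · refine Eq.trans ?_ (key (p := Complex.sinh (lam * ξ) - Complex.sin (lam * ξ))
      (q := (Complex.sinh (lam * ξ) + Complex.sin (lam * ξ)) * lam ^ 2)
      (r := -(2 * lam ^ 3)) ?_)
    · ring
    · unfold detAlpha Delta0 thirdNumerator firstNumerator Delta1 Delta3
      ring

/-- With `L₁`, `L₂` the expressions for `u(1)`, `u''(1)`, the combinations `λ² L₁ ± L₂` separate the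
hyperbolic from the trigonometric terms. The known contribution of `U = u₁(ξ)` is absorbed in `A`
and `B`; the one of `X` stays on the left. -/
theorem isBoundaryData_iff (ha : a ≠ 0) (hl : lam ≠ 0) {w₀ w₂ w U : ℂ}
    (hA : A = lam ^ 2 * w₀ + lam ^ 2 * α * U * kernel a lam 0 (1 - ξ))
    (hB : B = w₂ + α * U * kernel a lam 2 (1 - ξ)) (hC : C = lam ^ 2 * w) :
    IsBoundaryData a α ξ μ lam A B C X c₁ c₃ ↔
      (w₀ + (a * c₁ * kernel a lam 0 1 + a * c₃ * kernel a lam 2 1)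
          + α * (U - μ * X) * kernel a lam 0 (1 - ξ) = 0 ∧
        w₂ + (a * c₁ * kernel a lam 2 1 + a * c₃ * kernel a lam 4 1)
          + α * (U - μ * X) * kernel a lam 2 (1 - ξ) = 0 ∧
        w + (a * c₁ * kernel a lam 0 ξ + a * c₃ * kernel a lam 2 ξ) = X) := by
  have ha' : (a : ℂ) ≠ 0 := by exact_mod_cast ha
  have hs : Complex.sinh (lam * (1 - ξ)) = -Complex.sinh (lam * (ξ - 1)) := by
    rw [← Complex.sinh_neg]; ring_nf
  have hs' : Complex.sin (lam * (1 - ξ)) = -Complex.sin (lam * (ξ - 1)) := by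
    rw [← Complex.sin_neg]; ring_nf
  simp only [kernel, Complex.ofReal_sub, Complex.ofReal_one, mul_one, hs, hs'] at *
  subst hA hB hC
  rw [isBoundaryData_iff_and]
  generalize Complex.sinh (lam * (ξ - 1)) = Q
  generalize Complex.sin (lam * (ξ - 1)) = q
  generalize Complex.sinh (lam * ξ) = P
  generalize Complex.sin (lam * ξ) = p
  generalize Complex.sinh lam = S
  generalize Complex.sin lam = s
  have i3 (L₃ : ℂ) (h : L₃ = w + (a * c₁ * (1 / (2 * a * lam ^ 3) * (P - p))
      + a * c₃ * (1 / (2 * a * lam) * (P + p)))) :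
      P * (c₁ + lam ^ 2 * c₃) + p * (lam ^ 2 * c₃ - c₁) - 2 * lam ^ 3 * X
        + 2 * lam * (lam ^ 2 * w) = 2 * lam ^ 3 * (L₃ - X) := by
    subst h; field_simp; ring
  have i12 (L₁ L₂ : ℂ) (h1 : L₁ = w₀ + (a * c₁ * (1 / (2 * a * lam ^ 3) * (S - s))
        + a * c₃ * (1 / (2 * a * lam) * (S + s)))
        + α * (U - μ * X) * (1 / (2 * a * lam ^ 3) * (-Q - -q)))
      (h2 : L₂ = w₂ + (a * c₁ * (1 / (2 * a * lam) * (S + s))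
        + a * c₃ * (lam ^ 4 * (1 / (2 * a * lam ^ 3) * (S - s))))
        + α * (U - μ * X) * (1 / (2 * a * lam) * (-Q + -q))) :
      S * (c₁ + lam ^ 2 * c₃) + α * μ / a * Q * X
          + lam * (lam ^ 2 * w₀ + lam ^ 2 * α * U * (1 / (2 * a * lam ^ 3) * (-Q - -q))
            + (w₂ + α * U * (1 / (2 * a * lam) * (-Q + -q)))) = lam * (lam ^ 2 * L₁ + L₂) ∧
      s * (lam ^ 2 * c₃ - c₁) - α * μ / a * q * X
          + lam * (lam ^ 2 * w₀ + lam ^ 2 * α * U * (1 / (2 * a * lam ^ 3) * (-Q - -q))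
            - (w₂ + α * U * (1 / (2 * a * lam) * (-Q + -q)))) = lam * (lam ^ 2 * L₁ - L₂) := by
    subst h1 h2
    constructor <;> (field_simp; ring)
  obtain ⟨i1, i2⟩ := i12 _ _ rfl rfl
  have i3 := i3 _ rfl
  constructor
  · rintro ⟨e1, e2, e3⟩
    rw [← sub_eq_zero, sub_neg_eq_add] at e1 e2 e3
    rw [i1] at e1
    rw [i2] at e2
    rw [i3] at e3
    have hl3 : 2 * lam ^ 3 ≠ 0 := by simpa using hl
    have f1 := (mul_eq_zero.1 e1).resolve_left hl
    have f2 := (mul_eq_zero.1 e2).resolve_left hl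
    have f3 := (mul_eq_zero.1 e3).resolve_left hl3
    refine ⟨?_, by linear_combination (f1 - f2) / 2, sub_eq_zero.1 f3⟩
    exact mul_left_cancel₀ (pow_ne_zero 2 hl) (by linear_combination (f1 + f2) / 2)
  · rintro ⟨e1, e2, e3⟩
    rw [e1, e2] at i1 i2
    rw [e3] at i3
    exact ⟨by linear_combination i1, by linear_combination i2, by linear_combination i3⟩

end

/-! ### The regular part of the solution and the point source. -/

/-- The derivatives of the solution of `a w'''' - a λ⁴ w = f` on `(0, 1)` with
`w(0) = w''(0) = 0`, `w'(0) = c₃` and `w'''(0) = c₁`. -/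
def smoothPart (a : ℝ) (lam : ℂ) (f : ℝ → ℂ) (c₁ c₃ : ℂ) (j : ℕ) (x : ℝ) : ℂ :=
  convDeriv a lam f j x + (a * c₁ * kernel a lam j x + a * c₃ * kernel a lam (j + 2) x)

theorem isPrimitiveChain_kernel (a : ℝ) {lam : ℂ} (hl : lam ≠ 0) (i m : ℕ) (c d : ℝ) :
    IsPrimitiveChain m c d (fun j => kernel a lam (j + i)) :=
  IsPrimitiveChain.of_hasDerivAt (fun j x => by
    simpa [add_right_comm] using hasDerivAt_kernel a hl (j + i) x) m c d

theorem isPrimitiveChain_kernel_shift (a : ℝ) {lam : ℂ} (hl : lam ≠ 0) (ξ : ℝ) (m : ℕ) (c d : ℝ) :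
    IsPrimitiveChain m c d (fun j x => kernel a lam j (x - ξ)) :=
  IsPrimitiveChain.of_hasDerivAt
    (fun j x => (hasDerivAt_kernel a hl j (x - ξ)).comp_sub_const x ξ) m c d

theorem isPrimitiveChain_smoothPart {a : ℝ} (ha : a ≠ 0) {lam : ℂ} (hl : lam ≠ 0) {f : ℝ → ℂ}
    (hf : MemL2 0 1 f) (c₁ c₃ : ℂ) : IsPrimitiveChain 4 0 1 (smoothPart a lam f c₁ c₃) :=
  (isPrimitiveChain_convDeriv ha hl hf).add
    (((isPrimitiveChain_kernel a hl 0 4 0 1).const_mul _).add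
      ((isPrimitiveChain_kernel a hl 2 4 0 1).const_mul _) zero_le_one) zero_le_one

theorem smoothPart_four (a : ℝ) (lam : ℂ) (f : ℝ → ℂ) (c₁ c₃ : ℂ) (x : ℝ) :
    smoothPart a lam f c₁ c₃ 4 x = lam ^ 4 * smoothPart a lam f c₁ c₃ 0 x + f x / a := by
  simp only [smoothPart, convDeriv, kernel]; ring

theorem smoothPart_at_zero {a : ℝ} (ha : a ≠ 0) (lam : ℂ) (f : ℝ → ℂ) (c₁ c₃ : ℂ) :
    smoothPart a lam f c₁ c₃ 0 0 = 0 ∧ smoothPart a lam f c₁ c₃ 1 0 = c₃ ∧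
    smoothPart a lam f c₁ c₃ 2 0 = 0 ∧ smoothPart a lam f c₁ c₃ 3 0 = c₁ := by
  have ha' : (a : ℂ) ≠ 0 := by exact_mod_cast ha
  simp only [smoothPart, convDeriv, conv_zero]
  rw [kernel_add_four a lam 0, kernel_add_four a lam 1, kernel_three_zero ha,
    kernel_zero a lam (n := 0) (by norm_num), kernel_zero a lam (n := 1) (by norm_num),
    kernel_zero a lam (n := 2) (by norm_num)]
  refine ⟨by ring, by field_simp; ring, by ring, by field_simp; ring⟩

theorem IsTestFunction.iteratedDeriv {c d : ℝ} {φ : ℝ → ℂ} (h : IsTestFunction c d φ) (n : ℕ) :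
    IsTestFunction c d (iteratedDeriv n φ) := by
  induction n with
  | zero => simpa using h
  | succ n ih => rw [iteratedDeriv_succ]; exact ih.deriv

/-- `a ∂⁴ u₀(λ, · - ξ) - a λ⁴ u₀(λ, · - ξ) = δ_ξ`. -/
theorem integral_shift_mul_iteratedDeriv_four {a : ℝ} (ha : a ≠ 0) {lam : ℂ} (hl : lam ≠ 0) {ξ : ℝ}
    (hξ : ξ ∈ Ioo (0 : ℝ) 1) {φ : ℝ → ℂ} (hφ : IsTestFunction 0 1 φ) :
    ∫ x in Ioo (0 : ℝ) 1, kernel a lam 0 (x - ξ) * heaviside (x - ξ) * iteratedDeriv 4 φ x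
      = φ ξ / a + lam ^ 4 *
        ∫ x in Ioo (0 : ℝ) 1, kernel a lam 0 (x - ξ) * heaviside (x - ξ) * φ x := by
  have hH : ∀ (j : ℕ) (ψ : ℝ → ℂ), ∫ x in Ioo (0 : ℝ) 1, kernel a lam j (x - ξ) * heaviside (x - ξ) * ψ x
      = ∫ x in ξ..1, kernel a lam j (x - ξ) * ψ x := by
    intro j ψ
    have h2 : (fun x => kernel a lam j (x - ξ) * heaviside (x - ξ) * ψ x)
        = (Ici ξ).indicator fun x => kernel a lam j (x - ξ) * ψ x := by
      ext t; by_cases h : ξ ≤ t <;> simp [heaviside, indicator, h]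
    rw [h2, setIntegral_indicator measurableSet_Ici, intervalIntegral.integral_of_le hξ.2.le,
      integral_Ioc_eq_integral_Ioo]
    have : Ioo (0 : ℝ) 1 ∩ Ici ξ = Ico ξ 1 := by
      ext t; simp only [mem_inter_iff, mem_Ioo, mem_Ici, mem_Ico]
      exact ⟨fun h => ⟨h.2, h.1.2⟩, fun h => ⟨⟨hξ.1.trans_le h.1, h.2⟩, h.1⟩⟩
    rw [this, integral_Ico_eq_integral_Ioo]
  have hS := (isPrimitiveChain_shift_heaviside a hl hξ.1.le (zero_le_one (α := ℝ))).isSobolevDerivs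
    zero_le_one (fun _ _ => rfl)
  rw [iteratedDeriv_succ', hS.integral_mul_iteratedDeriv hφ.deriv le_rfl, hH, hH]
  -- The third derivative jumps at `ξ`, so the last integration by parts is done on `[ξ, 1]`; its
  -- boundary term at `ξ` produces the Dirac mass with weight `1 / a`.
  have hparts := intervalIntegral.integral_mul_deriv_eq_deriv_mul (a := ξ) (b := 1)
    (u := fun x => kernel a lam 3 (x - ξ)) (u' := fun x => kernel a lam 4 (x - ξ)) (v := φ)
    (v' := deriv φ) (fun x _ => (hasDerivAt_kernel a hl 3 (x - ξ)).comp_sub_const x ξ)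
    (fun x _ => (hφ.differentiable x).hasDerivAt)
    (((continuous_kernel a hl 4).comp (continuous_id.sub continuous_const)).intervalIntegrable _ _)
    (hφ.deriv.continuous.intervalIntegrable _ _)
  rw [hparts, hφ.eq_zero (x := 1) (by simp), sub_self, kernel_three_zero ha]
  have : ∀ x, kernel a lam 4 (x - ξ) * φ x = lam ^ 4 * (kernel a lam 0 (x - ξ) * φ x) := fun x => by
    rw [← mul_assoc]; rfl
  simp only [this, intervalIntegral.integral_const_mul]
  ring

theorem memL2_f10 (b : ℝ) (μ : ℂ) {u₁ v₁ : ℝ → ℂ} (h : InEnergySpace u₁ v₁) :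
    MemL2 0 1 (f10 b μ u₁ v₁) := by
  obtain ⟨D, hD⟩ := h.sobolev
  have : ContinuousOn u₁ (Icc 0 1) := (hD.cont 0 (by norm_num)).congr fun x hx => (hD.zero x hx).symm
  exact MemLp.add (memL2_of_continuousOn (continuousOn_const.mul this)) h.memL2

/-! ### Solutions of the resolvent equation. -/

variable {a b α ξ : ℝ} {μ lam : ℂ} {u₁ v₁ : ℝ → ℂ}

/-- On an interval that does not contain `ξ`, a solution satisfies `a u'''' = a λ⁴ u + f₁⁰`. -/
theorem fourth_deriv_eq (ha : a ≠ 0) (hlam : lam ^ 4 = -((b : ℂ) * μ + μ ^ 2) / (a : ℂ))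
    {u v w z : ℝ → ℂ} (h : OperatorMapsTo a b α ξ u v w z)
    (hv : ∀ x ∈ Icc (0 : ℝ) 1, v x = μ * u x - u₁ x)
    (hz : ∀ᵐ x ∂(volume.restrict (Ioo (0 : ℝ) 1)), μ * v x - z x = v₁ x) {p q : ℝ}
    (hp : 0 ≤ p) (hq : q ≤ 1) (hpq : ξ ∉ Ioo p q) {D : ℕ → ℝ → ℂ}
    (hD : IsSobolevDerivs 4 p q u D) :
    ∀ᵐ x ∂(volume.restrict (Ioo p q)), D 4 x = lam ^ 4 * D 0 x + f10 b μ u₁ v₁ x / a := by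
  have ha' : (a : ℂ) ≠ 0 := by exact_mod_cast ha
  have hzi := (h.memL2.mono hp hq).integrableOn
  have hvi := (h.domain.energy.memL2.mono hp hq).integrableOn
  have hDi := (hD.memL2 4 le_rfl).integrableOn
  have key : ∀ᵐ x ∂(volume.restrict (Ioo p q)), z x + a * D 4 x + b * v x = 0 := by
    refine ae_eq_zero_of_forall_test ((hzi.add (hDi.const_mul a)).add (hvi.const_mul b))
      fun φ hφ => ?_
    have e := h.snd φ (hφ.mono hp hq)
    -- A test function supported in `(p, q)` vanishes at `ξ`, so the Dirac term drops out.
    rw [hφ.eq_zero hpq, hφ.integral_Ioo_mul hp hq, hφ.integral_Ioo_mul hp hq,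
      (hφ.iteratedDeriv 4).integral_Ioo_mul hp hq, hD.integral_mul_iteratedDeriv hφ le_rfl] at e
    have h1 := hφ.integrableOn_mul hzi
    have h2 := (hφ.integrableOn_mul hDi).const_mul (a : ℂ)
    have h3 := (hφ.integrableOn_mul hvi).const_mul (b : ℂ)
    simp only [add_mul, mul_assoc]
    have h12 : IntegrableOn (fun x => z x * φ x + a * (D 4 x * φ x)) (Ioo p q) := h1.add h2
    rw [integral_add h12 h3, integral_add h1 h2, integral_const_mul, integral_const_mul, e]
    ring
  have hsub : Ioo p q ⊆ Ioo 0 1 := Ioo_subset_Ioo hp hq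
  filter_upwards [key, ae_mono (Measure.restrict_mono hsub le_rfl) hz,
    ae_restrict_mem measurableSet_Ioo] with x hx hzx hxm
  rw [hD.zero x (Ioo_subset_Icc_self hxm), hlam, f10]
  rw [hv x (Ioo_subset_Icc_self (hsub hxm))] at hx hzx
  field_simp
  linear_combination hx + hzx

/-- Every solution of the resolvent equation is of the expected form, and its free parameters
solve the linear system for the boundary conditions. -/
theorem SolvesResolvent.representation (ha : a ≠ 0) (hξ : ξ ∈ Ioo (0 : ℝ) 1) (hl : lam ≠ 0)
    (hlam : lam ^ 4 = -((b : ℂ) * μ + μ ^ 2) / (a : ℂ)) (hF : InEnergySpace u₁ v₁) {u v : ℝ → ℂ}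
    (h : SolvesResolvent a b α ξ μ u₁ v₁ u v) :
    (∀ x ∈ Icc (0 : ℝ) 1, v x = μ * u x - u₁ x) ∧ ∃ c₁ c₃ : ℂ,
      (∀ x ∈ Icc (0 : ℝ) 1, u x = smoothPart a lam (f10 b μ u₁ v₁) c₁ c₃ 0 x
        + α * (u₁ ξ - μ * u ξ) * u0 a lam (x - ξ)) ∧
      smoothPart a lam (f10 b μ u₁ v₁) c₁ c₃ 0 1
        + α * (u₁ ξ - μ * u ξ) * kernel a lam 0 (1 - ξ) = 0 ∧
      smoothPart a lam (f10 b μ u₁ v₁) c₁ c₃ 2 1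
        + α * (u₁ ξ - μ * u ξ) * kernel a lam 2 (1 - ξ) = 0 ∧
      smoothPart a lam (f10 b μ u₁ v₁) c₁ c₃ 0 ξ = u ξ := by
  obtain ⟨w, z, hop, h1, hz⟩ := h
  have hv : ∀ x ∈ Icc (0 : ℝ) 1, v x = μ * u x - u₁ x := fun x hx => by
    rw [← h1 x hx, hop.fst x hx]; ring
  refine ⟨hv, ?_⟩
  obtain ⟨l, r, hl', hr', hl20, hr21, hlr2, hlr3⟩ := hop.domain.pieces
  obtain ⟨D, hD⟩ := hop.domain.energy.sobolev
  have hξ1 : ξ ∈ Icc (0 : ℝ) 1 := Ioo_subset_Icc_self hξ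
  have h0ξ : ξ ∈ Icc (0 : ℝ) ξ := right_mem_Icc.2 hξ.1.le
  have hξξ : ξ ∈ Icc ξ 1 := left_mem_Icc.2 hξ.2.le
  have hL := IsPrimitiveChain.of_isSobolevDerivs hl' hξ.1
  have hR := IsPrimitiveChain.of_isSobolevDerivs hr' hξ.2
  have hDc := IsPrimitiveChain.of_isSobolevDerivs hD zero_lt_one
  set f := f10 b μ u₁ v₁
  have hf : MemL2 0 1 f := memL2_f10 b μ hF
  set k := α * (u₁ ξ - μ * u ξ) with hk
  have hS := isPrimitiveChain_smoothPart ha hl hf (l 3 0) (l 1 0)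
  obtain ⟨s0, s1, s2, s3⟩ := smoothPart_at_zero ha lam f (l 3 0) (l 1 0)
  set S := smoothPart a lam f (l 3 0) (l 1 0) with hSdef
  -- The transmission conditions do not mention the first derivative; its continuity at `ξ` comes
  -- from `u` being in `H²(0, 1)`.
  have hlr1 : l 1 ξ = r 1 ξ := by
    have e1 := (hL.mono (n := 2) (by norm_num)).deriv_eq
      (hDc.restrict zero_le_one le_rfl hξ.1.le hξ.2.le) hξ.1
      (fun x hx => (hl'.zero x hx).trans (hD.zero x ⟨hx.1, hx.2.trans hξ.2.le⟩).symm)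
      (j := 1) (by norm_num) h0ξ
    have e2 := (hR.mono (n := 2) (by norm_num)).deriv_eq
      (hDc.restrict zero_le_one hξ.1.le hξ.2.le le_rfl) hξ.2
      (fun x hx => (hr'.zero x hx).trans (hD.zero x ⟨hξ.1.le.trans hx.1, hx.2⟩).symm)
      (j := 1) (by norm_num) hξξ
    rw [e1, e2]
  -- The parameters of `S` were chosen as `l 3 0` and `l 1 0`, so `l - S` solves the homogeneous
  -- equation with zero initial data at 0.
  have hleft : ∀ j < 4, ∀ x ∈ Icc 0 ξ, l j x = S j x := by
    intro j hj x hx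
    refine sub_eq_zero.1 ((hL.sub (hS.restrict zero_le_one le_rfl hξ.1.le hξ.2.le)
      hξ.1.le).eq_zero_of_fourth (lam ^ 4) ?_ ?_ hj hx)
    · filter_upwards [fourth_deriv_eq ha hlam hop hv hz le_rfl hξ.2.le (by simp) hl'] with y hy
      rw [hy, hSdef, smoothPart_four]; ring
    · intro i hi
      interval_cases i
      · rw [s0, hl'.zero 0 (left_mem_Icc.2 hξ.1.le), hop.domain.energy.left, sub_zero]
      · rw [s1, sub_self]
      · rw [s2, hl20, sub_zero]
      · rw [s3, sub_self]
  have hSr := hS.restrict zero_le_one hξ.1.le hξ.2.le le_rfl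
  -- The same argument starts at `ξ`: the first three data are continuous there, and the prescribed
  -- third-derivative jump `-(α/a) v(ξ)` equals `k / a`, which is `k * kernel a lam 3 0`.
  have hright : ∀ j < 4, ∀ x ∈ Icc ξ 1, r j x = S j x + k * kernel a lam j (x - ξ) := by
    intro j hj x hx
    refine sub_eq_zero.1 ((hR.sub (hSr.add
      ((isPrimitiveChain_kernel_shift a hl ξ 4 ξ 1).const_mul k) hξ.2.le)
      hξ.2.le).eq_zero_of_fourth (lam ^ 4) ?_ ?_ hj hx)
    · filter_upwards [fourth_deriv_eq ha hlam hop hv hz hξ.1.le le_rfl (by simp) hr'] with y hy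
      rw [hy, hSdef, smoothPart_four, kernel_add_four a lam 0]; ring
    · intro i hi
      rw [← hleft i hi ξ h0ξ, sub_self]
      interval_cases i
      · rw [kernel_zero a lam (by norm_num), hl'.zero ξ h0ξ, hr'.zero ξ hξξ]; ring
      · rw [kernel_zero a lam (by norm_num), hlr1]; ring
      · rw [kernel_zero a lam (by norm_num), hlr2]; ring
      · rw [kernel_three_zero ha, hk]
        rw [hv ξ hξ1] at hlr3
        linear_combination hlr3
  have h11 : (1 : ℝ) ∈ Icc ξ 1 := right_mem_Icc.2 hξ.2.le
  refine ⟨l 3 0, l 1 0, ?_⟩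
  rw [← hSdef]
  refine ⟨fun x hx => ?_, ?_, ?_, ?_⟩
  · rcases le_total x ξ with hxξ | hxξ
    · rw [u0_of_nonpos a lam (sub_nonpos.2 hxξ), ← hleft 0 (by norm_num) x ⟨hx.1, hxξ⟩,
        hl'.zero x ⟨hx.1, hxξ⟩]
      ring
    · rw [u0_of_nonneg a lam (sub_nonneg.2 hxξ), ← hright 0 (by norm_num) x ⟨hxξ, hx.2⟩,
        hr'.zero x ⟨hxξ, hx.2⟩]
  · rw [← hright 0 (by norm_num) 1 h11, hr'.zero 1 h11, hop.domain.energy.right]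
  · rw [← hright 2 (by norm_num) 1 h11, hr21]
  · rw [← hleft 0 (by norm_num) ξ h0ξ, hl'.zero ξ h0ξ]

/-- Conversely, free parameters that solve the linear system give a solution. -/
theorem exists_solvesResolvent (ha : a ≠ 0) (hξ : ξ ∈ Ioo (0 : ℝ) 1) (hl : lam ≠ 0)
    (hlam : lam ^ 4 = -((b : ℂ) * μ + μ ^ 2) / (a : ℂ)) (hF : InEnergySpace u₁ v₁)
    {X c₁ c₃ : ℂ}
    (e1 : smoothPart a lam (f10 b μ u₁ v₁) c₁ c₃ 0 1
        + α * (u₁ ξ - μ * X) * kernel a lam 0 (1 - ξ) = 0)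
    (e2 : smoothPart a lam (f10 b μ u₁ v₁) c₁ c₃ 2 1
        + α * (u₁ ξ - μ * X) * kernel a lam 2 (1 - ξ) = 0)
    (e3 : smoothPart a lam (f10 b μ u₁ v₁) c₁ c₃ 0 ξ = X) :
    ∃ u v, SolvesResolvent a b α ξ μ u₁ v₁ u v := by
  have ha' : (a : ℂ) ≠ 0 := by exact_mod_cast ha
  set f := f10 b μ u₁ v₁ with hfdef
  have hf : MemL2 0 1 f := memL2_f10 b μ hF
  set k := α * (u₁ ξ - μ * X) with hk
  have hS := isPrimitiveChain_smoothPart ha hl hf c₁ c₃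
  have hS4 := smoothPart_four a lam f c₁ c₃
  obtain ⟨s0, -, s2, -⟩ := smoothPart_at_zero ha lam f c₁ c₃
  set S := smoothPart a lam f c₁ c₃ with hSdef
  set T : ℕ → ℝ → ℂ := fun j x => kernel a lam j (x - ξ) * heaviside (x - ξ) with hT
  have hTc := isPrimitiveChain_shift_heaviside a hl hξ.1.le (zero_le_one (α := ℝ))
  set u : ℝ → ℂ := fun x => S 0 x + k * T 0 x with hu
  set v : ℝ → ℂ := fun x => μ * u x - u₁ x with hv
  have hTr (j : ℕ) {x : ℝ} (hx : ξ ≤ x) : T j x = kernel a lam j (x - ξ) := by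
    simp [hT, heaviside, hx]
  have hTl {x : ℝ} (hx : x ≤ ξ) : T 0 x = 0 := u0_of_nonpos a lam (sub_nonpos.2 hx)
  have huξ : u ξ = X := by simp only [hu]; rw [hTl le_rfl, e3, mul_zero, add_zero]
  have hvξ : v ξ = μ * X - u₁ ξ := by simp only [hv]; rw [huξ]
  have hu0 : u 0 = 0 := by simp only [hu]; rw [hTl hξ.1.le, s0, mul_zero, add_zero]
  have hu1 : u 1 = 0 := by simp only [hu]; rw [hTr 0 hξ.2.le, e1]
  have hU : IsPrimitiveChain 2 0 1 (fun j x => S j x + k * T j x) :=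
    (hS.mono (by norm_num)).add ((hTc.mono (by norm_num)).const_mul k) zero_le_one
  obtain ⟨D₁, hD₁⟩ := hF.sobolev
  have hV := (hU.const_mul μ).sub (IsPrimitiveChain.of_isSobolevDerivs hD₁ zero_lt_one) zero_le_one
  have hVs : IsSobolevDerivs 2 0 1 v _ := hV.isSobolevDerivs zero_le_one fun x hx => by
    rw [hD₁.zero x hx]
  have hUs : IsSobolevDerivs 2 0 1 u _ := hU.isSobolevDerivs zero_le_one fun x _ => rfl
  have huc : ContinuousOn u (Icc 0 1) := hU.cont 0 (by norm_num)
  have hu₁c : ContinuousOn u₁ (Icc 0 1) :=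
    (hD₁.cont 0 (by norm_num)).congr fun x hx => (hD₁.zero x hx).symm
  have hvc : ContinuousOn v (Icc 0 1) := (continuousOn_const.mul huc).sub hu₁c
  have hvL : MemL2 0 1 v := memL2_of_continuousOn hvc
  -- The image under the operator is dictated by the equation: its components must be `μ u - u₁ = v`
  -- and `μ v - v₁`.
  refine ⟨u, v, v, fun x => μ * v x - v₁ x, ⟨⟨⟨⟨_, hUs⟩, hu0, hu1, hvL⟩, ⟨_, hVs⟩, ?_, ?_, ?_⟩,
    fun _ _ => rfl, (MemLp.const_mul hvL μ).sub hF.memL2, ?_⟩, fun x _ => ?_,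
    ae_of_all _ fun x => ?_⟩
  · simp only [hv]; rw [hu0, hF.left]; ring
  · simp only [hv]; rw [hu1, hF.right]; ring
  · refine ⟨S, fun j x => S j x + k * kernel a lam j (x - ξ),
      (hS.restrict zero_le_one le_rfl hξ.1.le hξ.2.le).isSobolevDerivs hξ.1.le fun x hx => ?_,
      ((hS.restrict zero_le_one hξ.1.le hξ.2.le le_rfl).add
        ((isPrimitiveChain_kernel_shift a hl ξ 4 ξ 1).const_mul k) hξ.2.le).isSobolevDerivs
        hξ.2.le fun x hx => ?_, s2, e2, ?_, ?_⟩
    · simp only [hu]; rw [hTl hx.2]; ring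
    · simp only [hu]; rw [hTr 0 hx.1]
    · simp only []; rw [sub_self, kernel_zero a lam (by norm_num)]; ring
    · simp only []; rw [sub_self, kernel_three_zero ha, hvξ, hk]; ring
  · intro φ hφ
    have hi {g : ℝ → ℂ} (hg : MemL2 0 1 g) {ψ : ℝ → ℂ} (hψ : IsTestFunction 0 1 ψ) :
        IntegrableOn (fun x => g x * ψ x) (Ioo 0 1) := hψ.integrableOn_mul hg.integrableOn
    have hSs := hS.isSobolevDerivs (u := S 0) zero_le_one fun _ _ => rfl
    have hφ4 := hφ.iteratedDeriv 4
    have hu₁L := memL2_of_continuousOn hu₁c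
    have huL := memL2_of_continuousOn huc
    have hS0L := hS.memL2 (j := 0) (by norm_num)
    have hT0L := hTc.memL2 (j := 0) (by norm_num)
    have i1 : ∫ x in Ioo (0 : ℝ) 1, u x * iteratedDeriv 4 φ x
        = (∫ x in Ioo (0 : ℝ) 1, S 0 x * iteratedDeriv 4 φ x)
          + k * ∫ x in Ioo (0 : ℝ) 1, T 0 x * iteratedDeriv 4 φ x := by
      rw [← integral_const_mul, ← integral_add (hi hS0L hφ4) ((hi hT0L hφ4).const_mul k)]
      exact integral_congr_ae (ae_of_all _ fun x => by simp only [hu]; ring)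
    have i2 : ∫ x in Ioo (0 : ℝ) 1, u x * φ x
        = (∫ x in Ioo (0 : ℝ) 1, S 0 x * φ x) + k * ∫ x in Ioo (0 : ℝ) 1, T 0 x * φ x := by
      rw [← integral_const_mul, ← integral_add (hi hS0L hφ) ((hi hT0L hφ).const_mul k)]
      exact integral_congr_ae (ae_of_all _ fun x => by simp only [hu]; ring)
    have i3 : ∫ x in Ioo (0 : ℝ) 1, S 4 x * φ x = lam ^ 4 * (∫ x in Ioo (0 : ℝ) 1, S 0 x * φ x)
        + ((μ + b) / a * (∫ x in Ioo (0 : ℝ) 1, u₁ x * φ x)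
          + 1 / a * ∫ x in Ioo (0 : ℝ) 1, v₁ x * φ x) := by
      have hg : IntegrableOn (fun x => (μ + b) / a * (u₁ x * φ x) + 1 / a * (v₁ x * φ x))
        (Ioo 0 1) := ((hi hu₁L hφ).const_mul _).add ((hi hF.memL2 hφ).const_mul _)
      rw [← integral_const_mul, ← integral_const_mul, ← integral_const_mul,
        ← integral_add ((hi hu₁L hφ).const_mul _) ((hi hF.memL2 hφ).const_mul _),
        ← integral_add ((hi hS0L hφ).const_mul _) hg]
      refine integral_congr_ae (ae_of_all _ fun x => ?_)
      simp only [hS4, hfdef, f10]; ring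
    have i4 : ∫ x in Ioo (0 : ℝ) 1, v x * φ x = μ * (∫ x in Ioo (0 : ℝ) 1, u x * φ x)
        - ∫ x in Ioo (0 : ℝ) 1, u₁ x * φ x := by
      rw [← integral_const_mul, ← integral_sub ((hi huL hφ).const_mul _) (hi hu₁L hφ)]
      exact integral_congr_ae (ae_of_all _ fun x => by simp only [hv]; ring)
    have i5 : ∫ x in Ioo (0 : ℝ) 1, (μ * v x - v₁ x) * φ x
        = μ * (∫ x in Ioo (0 : ℝ) 1, v x * φ x) - ∫ x in Ioo (0 : ℝ) 1, v₁ x * φ x := by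
      rw [← integral_const_mul, ← integral_sub ((hi hvL hφ).const_mul _) (hi hF.memL2 hφ)]
      exact integral_congr_ae (ae_of_all _ fun x => by ring)
    have i6 := integral_shift_mul_iteratedDeriv_four ha hl hξ hφ
    have i7 := hSs.integral_mul_iteratedDeriv hφ le_rfl
    change ∫ x in Ioo (0 : ℝ) 1, T 0 x * iteratedDeriv 4 φ x
      = φ ξ / a + lam ^ 4 * ∫ x in Ioo (0 : ℝ) 1, T 0 x * φ x at i6
    -- Everything is now expressed by `φ ξ` and the integrals of `φ` against `S 0`, `T 0`, `u₁`,
    -- `v₁`. The value of `λ⁴` cancels the first two, and `k` matches the Dirac term.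
    rw [i5, i1, i7, i6, i3, i4, i2, hvξ, hk, hlam]
    field_simp
    ring
  · simp only [hv]; ring
  · ring

end Beam

end

/-! ### The explicit resolvent formula. -/

theorem mainTheorem6 (a b α ξ : ℝ) (ha : 0 < a) (hb : 0 < b) (hα : 0 < α)
    (hξ : ξ ∈ Set.Ioo (0 : ℝ) 1) (μ lam : ℂ)
    (hlam : lam ^ 4 = -((b : ℂ) * μ + μ ^ 2) / (a : ℂ))
    (hdet : Beam.detAlpha a α ξ μ lam ≠ 0)
    (u₁ v₁ : ℝ → ℂ) (hF : Beam.InEnergySpace u₁ v₁) :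
    (∃ u v : ℝ → ℂ, Beam.SolvesResolvent a b α ξ μ u₁ v₁ u v) ∧
    ∀ u v : ℝ → ℂ, Beam.SolvesResolvent a b α ξ μ u₁ v₁ u v →
      ∀ x ∈ Set.Icc (0 : ℝ) 1,
        u x = 1 / Beam.detAlpha a α ξ μ lam *
            (Beam.detZeroResolventZero a b α ξ μ lam u₁ v₁ x
              + α * Beam.correction a b α ξ μ lam u₁ v₁ x) ∧
        (Beam.detZero lam ≠ 0 →
          u x = 1 / Beam.detAlpha a α ξ μ lam *
            (Beam.detZero lam * Beam.resolventZero a b α ξ μ lam u₁ v₁ x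
              + α * Beam.correction a b α ξ μ lam u₁ v₁ x)) ∧
        v x = μ * u x - u₁ x := by
  have hl : lam ≠ 0 := by
    rintro rfl
    simp [Beam.detAlpha] at hdet
  have hf := Beam.memL2_f10 b μ hF
  have h1ξ : 0 ≤ 1 - ξ := by linarith [hξ.2]
  have hA : Beam.coeffA a b α ξ μ lam u₁ v₁
      = lam ^ 2 * Beam.conv (Beam.kernel a lam 0) (Beam.f10 b μ u₁ v₁) 1
        + lam ^ 2 * α * u₁ ξ * Beam.kernel a lam 0 (1 - ξ) := by
    rw [Beam.coeffA, Beam.conv_u0 a lam _ zero_le_one, Beam.u0_of_nonneg a lam h1ξ]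
  have hB : Beam.coeffB a b α ξ μ lam u₁ v₁
      = Beam.conv (Beam.kernel a lam 2) (Beam.f10 b μ u₁ v₁) 1
        + α * u₁ ξ * Beam.kernel a lam 2 (1 - ξ) := by
    rw [Beam.coeffB, Beam.iteratedDeriv_two_conv_u0 a hl hf, Beam.u0xx_of_nonneg a hl h1ξ]
  have hC : Beam.coeffC a b ξ μ lam u₁ v₁
      = lam ^ 2 * Beam.conv (Beam.kernel a lam 0) (Beam.f10 b μ u₁ v₁) ξ := by
    rw [Beam.coeffC, Beam.conv_u0 a lam _ hξ.1.le]
  have hiff : ∀ {X c₁ c₃ : ℂ}, _ := @fun X c₁ c₃ =>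
    Beam.isBoundaryData_iff (μ := μ) (X := X) (c₁ := c₁) (c₃ := c₃) ha.ne' hl hA hB hC
  refine ⟨?_, fun u v h x hx => ?_⟩
  · obtain ⟨e1, e2, e3⟩ := hiff.1 (Beam.isBoundaryData_of_det_ne_zero hdet _ _ _)
    exact Beam.exists_solvesResolvent ha.ne' hξ hl hlam hF e1 e2 e3
  · obtain ⟨hv, c₁, c₃, hu, e1, e2, e3⟩ := h.representation ha.ne' hξ hl hlam hF
    obtain ⟨hX, h1, h3⟩ := (hiff.2 ⟨e1, e2, e3⟩).cramer hl
    have hmain : u x = 1 / Beam.detAlpha a α ξ μ lam *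
        (Beam.detZeroResolventZero a b α ξ μ lam u₁ v₁ x
          + α * Beam.correction a b α ξ μ lam u₁ v₁ x) := by
      -- This splitting distributes the coefficient of `u₀ ⋆ f₁⁰` over the unperturbed resolvent and
      -- the correction.
      have hDD : Beam.detAlpha a α ξ μ lam = Beam.detZero lam + α * Beam.Delta a ξ μ lam := by
        unfold Beam.detAlpha Beam.detZero Beam.Delta; ring
      rw [one_div, eq_inv_mul_iff_mul_eq₀ hdet, hu x hx]
      simp only [Beam.smoothPart, Beam.convDeriv, Beam.detZeroResolventZero, Beam.correction,
        Beam.bracketZero, Beam.conv_u0 a lam _ hx.1, Beam.u0_of_nonneg a lam hx.1,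
        Beam.u0xx_of_nonneg a hl hx.1]
      -- Replacing `Δ₀` by `Det^α · u(ξ)` turns the coefficient of `u₀(x - ξ)` into `Det^α (u₁(ξ) -
      -- μ u(ξ))`.
      rw [← hX]
      unfold Beam.thirdNumerator at h1
      unfold Beam.firstNumerator at h3
      linear_combination Beam.conv (Beam.kernel a lam 0) (Beam.f10 b μ u₁ v₁) x * hDD
        + a * Beam.kernel a lam 0 x * h1 + a * Beam.kernel a lam 2 x * h3
    refine ⟨hmain, fun h0 => ?_, hv x hx⟩
    rw [hmain]
    congr 2
    rw [Beam.detZeroResolventZero, Beam.resolventZero]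
    field_simp
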